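/- For real numbers $0<b<a$ let $$\psi_{a,b}(x_1,x_2)=2\sin\Big(\frac{\pi x_1}{2a}\Big)\cos\Big(\frac{\pi x_2}{2b}\Big),\qquad \lambda_{a,b}=\frac{\pi^2}{4}\big(a^{-2}+b^{-2}\big),$$ so that $-\Delta\psi_{a,b}=\lambda_{a,b}\psi_{a,b}$ on $\mathbb R^2$. For a maximum $p$ and a minimum $q$ of $\psi_{a,b}$ let the Neumann domain $\Omega(p,q)$ be the set of all $x\in\mathbb R^2$ for which the solution of $\dot\gamma=-\nabla\psi_{a,b}(\gamma)$, $\gamma(0)=x$, satisfies $\gamma(t)\to p$ as $t\to-\infty$ and $\gamma(t)\to q$ as $t\to+\infty$. Let $\Omega^s_{a,b}=\Omega((a,0),(-a,0))$ be the star-like Neumann domain (its boundary has cusps at the two extrema) and $\Omega^l_{a,b}=\Omega((a,0),(a,2b))$ the lens-like one (its boundary has angle $\pi$ at the two extrema). For $i\in\{s,l\}$ put $$\rho^i_{a,b}=\frac{|\Omega^i_{a,b}|\,\sqrt{\lambda_{a,b}}}{\mathcal H^1(\partial\Omega^i_{a,b})},$$ where $|\cdot|$ is the area and $\mathcal H^1$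 the one-dimensional Hausdorff measure. The Neumann Laplacian on an open set $\Omega\subset\mathbb R^2$ is the self-adjoint operator of the quadratic form $u\mapsto\int_\Omega|\nabla u|^2\,dx$ with domain $H^1(\Omega)$. One says that $\Omega^i_{a,b}$ has the ground state property if the smallest eigenvalue of the Neumann Laplacian on $\Omega^i_{a,b}$ that has a non-constant eigenfunction exists and is simple, and its normalized real eigenfunction is, up to sign, $\psi_{a,b}/\|\psi_{a,b}\|_{L^2(\Omega^i_{a,b})}$. Then: 1. For all $0<b<a$ one has $0<\rho^s_{a,b}<\rho^l_{a,b}$. 2. The ground state property and the $\rho$-values depend only on the ratio $a/b$: if $0<b<a$, $0<b'<a'$ and $a/b=a'/b'$, then for $i\in\{s,l\}$ the domain $\Omega^i_{a,b}$ has the ground state property if and only if $\Omega^i_{a',b'}$ has it, and $\rho^i_{a,b}=\rho^i_{a',b'}$. -/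

import Mathlib

open MeasureTheory Filter Topology Set
open scoped ContDiff

noncomputable section

/-- The Euclidean plane. -/
abbrev Plane : Type := EuclideanSpace ℝ (Fin 2)

/-! ### Gradient flow, stable and unstable manifolds, Neumann domains -/

/-- `γ : ℝ → ℝ²` is a (global) gradient flow line of `f`: `γ'(t) = -∇f(γ(t))` for all `t`. -/
def IsGradientFlowLine (f : Plane → ℝ) (γ : ℝ → Plane) : Prop :=
  IsIntegralCurve γ (fun _ x => -gradient f x)

/-- The stable manifold of `m`: points whose flow line tends to `m` as `t → +∞`. -/
def stableManifold (f : Plane → ℝ) (m : Plane) : Set Plane :=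
  {x | ∃ γ : ℝ → Plane, IsGradientFlowLine f γ ∧ γ 0 = x ∧ Tendsto γ atTop (𝓝 m)}

/-- The unstable manifold of `m`: points whose flow line tends to `m` as `t → -∞`. -/
def unstableManifold (f : Plane → ℝ) (m : Plane) : Set Plane :=
  {x | ∃ γ : ℝ → Plane, IsGradientFlowLine f γ ∧ γ 0 = x ∧ Tendsto γ atBot (𝓝 m)}

/-- The Neumann domain `Ω(p, q)` of `f` belonging to a maximum `p` and a minimum `q`: all points
whose flow line (along which `f` decreases) comes from `p` and goes to `q`. -/
def neumannDomain (f : Plane → ℝ) (p q : Plane) : Set Plane :=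
  unstableManifold f p ∩ stableManifold f q

/-! ### The eigenfunctions and their star-like and lens-like Neumann domains -/

/-- `ψ_{a,b}(x₁, x₂) = 2 sin(π x₁ / (2a)) cos(π x₂ / (2b))`. -/
def psi (a b : ℝ) (x : Plane) : ℝ :=
  2 * Real.sin (Real.pi / (2 * a) * x 0) * Real.cos (Real.pi / (2 * b) * x 1)

/-- `λ_{a,b} = (π² / 4) (a⁻² + b⁻²)`, the eigenvalue of `-Δ` for `ψ_{a,b}`. -/
def lam (a b : ℝ) : ℝ :=
  Real.pi ^ 2 / 4 * ((a ^ 2)⁻¹ + (b ^ 2)⁻¹)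

/-- The star-like Neumann domain `Ω_{a,b}` of `ψ_{a,b}`, for `0 < b < a`, centred at the origin:
the one of the maximum `(a, 0)` and the minimum `(-a, 0)`. Its boundary has cusps at these two
extrema and right angles at the saddle points `(0, ±b)`. -/
def starDomain (a b : ℝ) : Set Plane :=
  neumannDomain (psi a b) !₂[a, 0] !₂[-a, 0]

/-- The lens-like Neumann domain of `ψ_{a,b}`, for `0 < b < a`, centred at `(a, b)`: the one of
the maximum `(a, 0)` and the minimum `(a, 2b)`. Its boundary has angle `π` at these two extrema
and right angles at the saddle points `(0, b)` and `(2a, b)`. -/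
def lensDomain (a b : ℝ) : Set Plane :=
  neumannDomain (psi a b) !₂[a, 0] !₂[a, 2 * b]

/-- `ρ = A √μ / l`, with `A` the area of `Ω` and `l` the perimeter of `Ω`, that is, the
one-dimensional Hausdorff measure of its boundary. -/
def rhoValue (Ω : Set Plane) (μ : ℝ) : ℝ :=
  (volume Ω).toReal * Real.sqrt μ / (Measure.hausdorffMeasure 1 (frontier Ω)).toReal

/-- `ρ^s_{a,b}`. -/
def rhoStar (a b : ℝ) : ℝ := rhoValue (starDomain a b) (lam a b)

/-- `ρ^l_{a,b}`. -/
def rhoLens (a b : ℝ) : ℝ := rhoValue (lensDomain a b) (lam a b)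

/-! ### The Neumann Laplacian in weak form and the ground state property -/

/-- `u ∈ H¹(Ω)` with weak gradient `g`: both are square integrable on `Ω`, and
`∫_Ω u ∂ᵢφ = -∫_Ω gᵢ φ` for every smooth `φ` with compact support in `Ω`. -/
def HasH1Gradient (Ω : Set Plane) (u : Plane → ℝ) (g : Plane → Plane) : Prop :=
  MemLp u 2 (volume.restrict Ω) ∧ MemLp g 2 (volume.restrict Ω) ∧
    ∀ φ : Plane → ℝ, ContDiff ℝ ∞ φ → HasCompactSupport φ → tsupport φ ⊆ Ω →
      ∀ i : Fin 2,
        ∫ x in Ω, u x * fderiv ℝ φ x (EuclideanSpace.single i 1) = -∫ x in Ω, g x i * φ x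

/-- `u` is an eigenfunction, with eigenvalue `μ`, of the Neumann Laplacian on `Ω`, the operator
of the quadratic form `∫_Ω |∇u|²` with domain `H¹(Ω)`: `u ∈ H¹(Ω)`, `u ≠ 0` and
`∫_Ω ∇u · ∇w = μ ∫_Ω u w` for all `w ∈ H¹(Ω)`. -/
def IsNeumannEigenfunction (Ω : Set Plane) (μ : ℝ) (u : Plane → ℝ) : Prop :=
  ∃ g : Plane → Plane, HasH1Gradient Ω u g ∧ ¬ (u =ᵐ[volume.restrict Ω] 0) ∧
    ∀ (w : Plane → ℝ) (k : Plane → Plane), HasH1Gradient Ω w k →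
      ∫ x in Ω, inner ℝ (g x) (k x) = μ * ∫ x in Ω, u x * w x

/-- `u` is (almost everywhere) constant on `Ω`. -/
def IsAEConst (Ω : Set Plane) (u : Plane → ℝ) : Prop :=
  ∃ c : ℝ, u =ᵐ[volume.restrict Ω] fun _ => c

/-- `μ` is the first non-constant Neumann eigenvalue of `Ω`: the least eigenvalue that has a
non-constant eigenfunction. -/
def IsFirstNonconstantEigenvalue (Ω : Set Plane) (μ : ℝ) : Prop :=
  IsLeast {ν : ℝ | ∃ u, IsNeumannEigenfunction Ω ν u ∧ ¬ IsAEConst Ω u} μ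

/-- The eigenspace of `μ` is at most one-dimensional. -/
def IsSimpleEigenvalue (Ω : Set Plane) (μ : ℝ) : Prop :=
  ∀ u v : Plane → ℝ, IsNeumannEigenfunction Ω μ u → IsNeumannEigenfunction Ω μ v →
    ∃ c : ℝ, v =ᵐ[volume.restrict Ω] fun x => c * u x

/-- `u` is a ground state of the Neumann Laplacian on `Ω`: the first non-constant eigenvalue
exists and is simple, and `u` is an `L²(Ω)`-normalized real eigenfunction for it (so `u` is unique
up to sign). -/
def IsGroundState (Ω : Set Plane) (u : Plane → ℝ) : Prop :=
  ∃ μ : ℝ, IsFirstNonconstantEigenvalue Ω μ ∧ IsSimpleEigenvalue Ω μ ∧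
    IsNeumannEigenfunction Ω μ u ∧ eLpNorm u 2 (volume.restrict Ω) = 1

/-- `Ω` has the ground state property with respect to `f`: the ground state `u` exists and equals
`f / ‖f‖_{L²(Ω)}` up to sign. -/
def HasGroundStateProperty (Ω : Set Plane) (f : Plane → ℝ) : Prop :=
  ∃ u : Plane → ℝ, IsGroundState Ω u ∧
    ((u =ᵐ[volume.restrict Ω] fun x => ((eLpNorm f 2 (volume.restrict Ω)).toReal)⁻¹ * f x) ∨
      (u =ᵐ[volume.restrict Ω] fun x => -(((eLpNorm f 2 (volume.restrict Ω)).toReal)⁻¹ * f x)))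

end

/-!
Put `α = π / (2a)`, `β = π / (2b)` and `κ = (β / α) ^ 2 = (a / b) ^ 2`. Seen from its centre, the
lens-like domain of `ψ_{a,b}` is a Neumann domain of `-2 cos (α x) sin (β y)`, namely that
of the maximum `(0, -b)` and the minimum `(0, b)`; seen from its centre and turned by a right angle, the
star-like domain is the same object with `a` and `b` exchanged. Along the flow, `sin (α x)` and
`cos (β y)` solve linear equations with rates `α² φ` and `β² φ`, where `φ` is the displayed function,
so that `|sin (α x)| ^ κ / cos (β y)` is a first integral. A flow line connecting the two extrema crosses `y = 0` away from the saddle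
points, hence has a value less than `1`; conversely, on such a level `cos (α x)` is bounded below, and
`sin (β y)` is driven to `±1` by a logistic inequality. The domain is therefore the cell
`|sin (α x)| ^ κ < cos (β y)` (`neumannDomain_cellPotential`).

The boundaries of the cells of `(a, b)` and `(b, a)` consist each of four copies of one and the same
arc (`hausdorffMeasure_frontier_cell`, `hausdorffMeasure_cellArc_swap`), which is monotone and so of
finite, positive length: the two perimeters agree. If `κ` were `1` the cell would be the rhombus
`|x| / a + |y| / b < 1`. For `b < a` the exponent is greater than `1` for the lens and less than `1`
for the star, so that the lens is larger than the rhombus and the star is contained in it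
(`volume_cell_lt_volume_cell`). This gives the inequality of the `ρ`-values.

Dependence on `a / b` only is the covariance of everything under the homothety `x ↦ c x`: it maps the
flow lines of `ψ_{a,b}` to those of `ψ_{ca,cb}` up to a change of time, multiplies areas by `c ^ 2` and
lengths by `c`, and transports weak gradients and Neumann eigenfunctions, dividing eigenvalues by
`c ^ 2` (`neumannDomain_comp_similarity`, `rhoValue_preimage_similarity`,
`hasGroundStateProperty_homothety_iff`).
-/

/-! ### Global flows of bounded Lipschitz fields -/

theorem exists_isIntegralCurve_of_lipschitzWith_of_bounded {E : Type*} [NormedAddCommGroup E]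
    [NormedSpace ℝ E] [CompleteSpace E] {v : E → E} {K L : NNReal} (hv : LipschitzWith K v)
    (hL : ∀ x, ‖v x‖ ≤ L) (x : E) : ∃ γ : ℝ → E, IsIntegralCurve γ (fun _ => v) ∧ γ 0 = x := by
  have hloc : ∀ n : ℕ, ∃ γ : ℝ → E, γ 0 = x ∧
      ∀ t ∈ Ioo (-(n + 1 : ℝ)) (n + 1), HasDerivAt γ (v (γ t)) t := by
    intro n
    have hn : (0 : ℝ) ≤ n := n.cast_nonneg
    -- The field is bounded by `L`, so that on `[-(n+1), n+1]` solutions stay within `L * (n + 1)`.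
    have hP : IsPicardLindelof (fun _ => v)
        (⟨0, by constructor <;> linarith⟩ : Icc (-(n + 1 : ℝ)) (n + 1)) x
        (L * (n + 1)) 0 L K :=
      { lipschitzOnWith := fun t _ => hv.lipschitzOnWith
        continuousOn := fun _ _ => continuousOn_const
        norm_le := fun _ _ y _ => hL y
        mul_max_le := by simp }
    obtain ⟨γ, h0, h⟩ := hP.exists_eq_forall_mem_Icc_hasDerivWithinAt₀
    exact ⟨γ, h0, fun t ht => (h t (Ioo_subset_Icc_self ht)).hasDerivAt (Icc_mem_nhds ht.1 ht.2)⟩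
  choose γ h0 hγ using hloc
  have hagree : ∀ m n : ℕ, m ≤ n → ∀ t ∈ Ioo (-(m + 1 : ℝ)) (m + 1), γ m t = γ n t := by
    intro m n hmn t ht
    have hm : (0 : ℝ) ≤ m := m.cast_nonneg
    have hmn' : (m : ℝ) ≤ n := by exact_mod_cast hmn
    refine ODE_solution_unique_of_mem_Ioo (v := fun _ => v) (s := fun _ => univ) (K := K)
      (t₀ := 0) (fun t _ => hv.lipschitzOnWith) (by constructor <;> linarith)
      (fun t ht => ⟨hγ m t ht, mem_univ _⟩) (fun t ht => ⟨hγ n t ?_, mem_univ _⟩)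
      (by rw [h0, h0]) ht
    constructor <;> linarith [ht.1, ht.2]
  refine ⟨fun t => γ ⌈|t|⌉₊ t, fun t => ?_, h0 _⟩
  set N := ⌈|t|⌉₊ + 1
  have ht : |t| < N := by
    have := Nat.le_ceil |t|
    push_cast [N]
    linarith
  have hev : (fun s => γ ⌈|s|⌉₊ s) =ᶠ[𝓝 t] γ N := by
    filter_upwards [continuous_abs.continuousAt.eventually_lt continuousAt_const ht] with s hs
    refine hagree _ _ (Nat.ceil_le.2 hs.le) s ?_
    exact abs_lt.1 (by linarith [Nat.le_ceil |s|])
  have ht' : t ∈ Ioo (-(N + 1 : ℝ)) (N + 1) := abs_lt.1 (by linarith)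
  have := (hγ N t ht').congr_of_eventuallyEq hev
  rwa [← hev.eq_of_nhds] at this

/-! ### Gradient flows and similarities -/

/-- The chain rule for the gradient under the similarity `x ↦ c • L x + v`. -/
theorem gradient_comp_similarity {f : Plane → ℝ} (hf : Differentiable ℝ f) (c : ℝ)
    (L : Plane ≃ₗᵢ[ℝ] Plane) (v x : Plane) :
    gradient (fun x => f (c • L x + v)) x = c • L.symm (gradient f (c • L x + v)) := by
  refine HasGradientAt.gradient ?_
  have h1 : HasFDerivAt (fun x => c • L x + v)
      (c • (L.toContinuousLinearEquiv : Plane →L[ℝ] Plane)) x :=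
    ((L.toContinuousLinearEquiv.hasFDerivAt (x := x)).const_smul c).add_const v
  have h2 := (hf (c • L x + v)).hasGradientAt.hasFDerivAt.comp x h1
  rw [hasGradientAt_iff_hasFDerivAt]
  refine h2.congr_fderiv ?_
  ext y
  simp only [ContinuousLinearMap.comp_apply, _root_.smul_apply,
    InnerProductSpace.toDual_apply_apply, inner_smul_left, inner_smul_right]
  rw [← L.inner_map_map (L.symm _)]
  simp

/-- A similarity of ratio `c` carries flow lines to flow lines, with time slowed by `c ^ 2`. -/
theorem IsGradientFlowLine.similarity {f : Plane → ℝ} (hf : Differentiable ℝ f) {c : ℝ}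
    (hc : 0 < c) (L : Plane ≃ₗᵢ[ℝ] Plane) (v : Plane) {γ : ℝ → Plane}
    (hγ : IsGradientFlowLine (fun x => f (c • L x + v)) γ) :
    IsGradientFlowLine f (fun t => c • L (γ (t * (c ^ 2)⁻¹)) + v) := by
  intro t
  have h1 := (hγ (t * (c ^ 2)⁻¹)).scomp t ((hasDerivAt_id t).mul_const (c ^ 2)⁻¹)
  have h2 := ((L.toContinuousLinearEquiv.hasFDerivAt.comp_hasDerivAt t h1).const_smul c).add_const v
  refine h2.congr_deriv ?_
  simp only [gradient_comp_similarity hf]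
  simp only [one_mul, ContinuousLinearEquiv.coe_coe, LinearIsometryEquiv.coe_toContinuousLinearEquiv,
    map_smul, map_neg, LinearIsometryEquiv.apply_symm_apply, smul_neg, smul_smul]
  rw [show c * ((c ^ 2)⁻¹ * c) = 1 by field_simp, one_smul]

theorem mem_neumannDomain_of_similarity {f : Plane → ℝ} (hf : Differentiable ℝ f) {c : ℝ}
    (hc : 0 < c) (L : Plane ≃ₗᵢ[ℝ] Plane) (v : Plane) {p q x : Plane}
    (hx : x ∈ neumannDomain (fun x => f (c • L x + v)) p q) :
    c • L x + v ∈ neumannDomain f (c • L p + v) (c • L q + v) := by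
  have hcont : Continuous fun y => c • L y + v := by fun_prop
  have hpos : 0 < (c ^ 2)⁻¹ := by positivity
  obtain ⟨⟨γ, hγ, h0, ht⟩, ⟨γ', hγ', h0', ht'⟩⟩ := hx
  exact ⟨⟨_, hγ.similarity hf hc L v, by simp [h0],
      (hcont.tendsto p).comp (ht.comp (tendsto_id.atBot_mul_const hpos))⟩,
    ⟨_, hγ'.similarity hf hc L v, by simp [h0'],
      (hcont.tendsto q).comp (ht'.comp (tendsto_id.atTop_mul_const hpos))⟩⟩

/-- Neumann domains are natural under similarities of the plane. -/
theorem neumannDomain_comp_similarity {f : Plane → ℝ} (hf : Differentiable ℝ f) {c : ℝ}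
    (hc : 0 < c) (L : Plane ≃ₗᵢ[ℝ] Plane) (v p q : Plane) :
    neumannDomain (fun x => f (c • L x + v)) p q =
      (fun x => c • L x + v) ⁻¹' neumannDomain f (c • L p + v) (c • L q + v) := by
  ext x
  refine ⟨mem_neumannDomain_of_similarity hf hc L v, fun hx => ?_⟩
  have hinv : ∀ y, c⁻¹ • L.symm y + -(c⁻¹ • L.symm v) = L.symm (c⁻¹ • (y - v)) := by
    intro y
    simp [sub_eq_add_neg]
  have hinv' : ∀ y, c⁻¹ • L.symm (c • L y + v) + -(c⁻¹ • L.symm v) = y := by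
    intro y
    simp [hc.ne']
  have hf' : Differentiable ℝ fun x => f (c • L x + v) := by
    refine hf.comp (Differentiable.add_const _ (Differentiable.const_smul ?_ c))
    exact L.toContinuousLinearEquiv.differentiable
  have key := mem_neumannDomain_of_similarity hf' (inv_pos.2 hc) L.symm (-(c⁻¹ • L.symm v))
    (p := c • L p + v) (q := c • L q + v) (x := c • L x + v)
  have hff : (fun y => f (c • L (c⁻¹ • L.symm y + -(c⁻¹ • L.symm v)) + v)) = f := by
    funext y
    rw [hinv]
    simp [hc.ne']
  rw [hff] at key
  simpa only [hinv'] using key hx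

/-! ### The cell potential and its flow -/

/-- The function `ψ_{a,b}` seen from `(a, b)`, the centre of the lens-like domain. With the two
coordinates exchanged it is also `ψ_{b,a}` seen from the centre of the star-like domain, so that
one family of domains, with no order imposed on `a` and `b`, describes both. -/
noncomputable def cellPotential (a b : ℝ) (x : Plane) : ℝ :=
  -(2 * Real.cos (Real.pi / (2 * a) * x 0) * Real.sin (Real.pi / (2 * b) * x 1))

/-- The Neumann domain of `cellPotential a b` belonging to `(0, -b)` and `(0, b)`, in explicit
form (see `neumannDomain_cellPotential`). The power is a real power with exponent `(a / b) ^ 2`, the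
squared ratio of the frequencies `π / (2b)` and `π / (2a)`. -/
def cell (a b : ℝ) : Set Plane :=
  {x | |x 0| < a ∧ |x 1| < b ∧
    |Real.sin (Real.pi / (2 * a) * x 0)| ^ ((a / b) ^ 2) < Real.cos (Real.pi / (2 * b) * x 1)}

theorem hasGradientAt_cellPotential (a b : ℝ) (x : Plane) :
    HasGradientAt (cellPotential a b)
      !₂[2 * (Real.pi / (2 * a)) * Real.sin (Real.pi / (2 * a) * x 0) *
          Real.sin (Real.pi / (2 * b) * x 1),
        -(2 * (Real.pi / (2 * b)) * Real.cos (Real.pi / (2 * a) * x 0) *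
          Real.cos (Real.pi / (2 * b) * x 1))] x := by
  rw [hasGradientAt_iff_hasFDerivAt]
  have h0 : HasFDerivAt (fun y : Plane => y 0) (EuclideanSpace.proj 0 : Plane →L[ℝ] ℝ) x :=
    (EuclideanSpace.proj 0 : Plane →L[ℝ] ℝ).hasFDerivAt
  have h1 : HasFDerivAt (fun y : Plane => y 1) (EuclideanSpace.proj 1 : Plane →L[ℝ] ℝ) x :=
    (EuclideanSpace.proj 1 : Plane →L[ℝ] ℝ).hasFDerivAt
  refine ((((h0.const_mul (Real.pi / (2 * a))).cos.const_mul 2).mul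
    (h1.const_mul (Real.pi / (2 * b))).sin).neg).congr_fderiv ?_
  ext y
  simp [InnerProductSpace.toDual_apply_apply, PiLp.inner_apply, Fin.sum_univ_two]
  ring

theorem differentiable_cellPotential (a b : ℝ) : Differentiable ℝ (cellPotential a b) :=
  fun x => (hasGradientAt_cellPotential a b x).hasFDerivAt.differentiableAt

/-- The velocity field of the flow is a sum of two plane waves. -/
theorem neg_gradient_cellPotential (a b : ℝ) (x : Plane) :
    -gradient (cellPotential a b) x =
      Real.cos (Real.pi / (2 * a) * x 0 - Real.pi / (2 * b) * x 1) •
        (!₂[-(Real.pi / (2 * a)), Real.pi / (2 * b)] : Plane) +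
      Real.cos (Real.pi / (2 * a) * x 0 + Real.pi / (2 * b) * x 1) •
        (!₂[Real.pi / (2 * a), Real.pi / (2 * b)] : Plane) := by
  rw [(hasGradientAt_cellPotential a b x).gradient]
  ext i
  fin_cases i <;> simp [Real.cos_sub, Real.cos_add] <;> ring

theorem exists_lipschitzWith_plane_wave (ℓ : Plane →L[ℝ] ℝ) (w : Plane) :
    ∃ K, LipschitzWith K fun x => Real.cos (ℓ x) • w :=
  ⟨_, (ContinuousLinearMap.toSpanSingleton ℝ w).lipschitz.comp
    (Real.lipschitzWith_cos.comp ℓ.lipschitz)⟩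

theorem exists_lipschitzWith_neg_gradient_cellPotential (a b : ℝ) :
    ∃ K, LipschitzWith K fun x => -gradient (cellPotential a b) x := by
  obtain ⟨K₁, h₁⟩ := exists_lipschitzWith_plane_wave
    ((Real.pi / (2 * a)) • EuclideanSpace.proj 0 - (Real.pi / (2 * b)) • EuclideanSpace.proj 1)
    !₂[-(Real.pi / (2 * a)), Real.pi / (2 * b)]
  obtain ⟨K₂, h₂⟩ := exists_lipschitzWith_plane_wave
    ((Real.pi / (2 * a)) • EuclideanSpace.proj 0 + (Real.pi / (2 * b)) • EuclideanSpace.proj 1)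
    !₂[Real.pi / (2 * a), Real.pi / (2 * b)]
  refine ⟨K₁ + K₂, ?_⟩
  simp only [neg_gradient_cellPotential]
  exact h₁.add h₂

theorem exists_norm_neg_gradient_cellPotential_le (a b : ℝ) :
    ∃ L : NNReal, ∀ x, ‖-gradient (cellPotential a b) x‖ ≤ L := by
  refine ⟨‖(!₂[-(Real.pi / (2 * a)), Real.pi / (2 * b)] : Plane)‖₊ +
    ‖(!₂[Real.pi / (2 * a), Real.pi / (2 * b)] : Plane)‖₊, fun x => ?_⟩
  rw [neg_gradient_cellPotential]
  refine (norm_add_le _ _).trans ?_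
  rw [norm_smul, norm_smul]
  push_cast
  exact add_le_add (mul_le_of_le_one_left (norm_nonneg _) (Real.abs_cos_le_one _))
    (mul_le_of_le_one_left (norm_nonneg _) (Real.abs_cos_le_one _))

theorem exists_isGradientFlowLine_cellPotential (a b : ℝ) (x : Plane) :
    ∃ γ, IsGradientFlowLine (cellPotential a b) γ ∧ γ 0 = x := by
  obtain ⟨K, hK⟩ := exists_lipschitzWith_neg_gradient_cellPotential a b
  obtain ⟨L, hL⟩ := exists_norm_neg_gradient_cellPotential_le a b
  exact exists_isIntegralCurve_of_lipschitzWith_of_bounded hK hL x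

theorem isGradientFlowLine_cellPotential_unique {a b : ℝ} {γ γ' : ℝ → Plane}
    (h : IsGradientFlowLine (cellPotential a b) γ) (h' : IsGradientFlowLine (cellPotential a b) γ')
    {t : ℝ} (heq : γ t = γ' t) : γ = γ' := by
  obtain ⟨K, hK⟩ := exists_lipschitzWith_neg_gradient_cellPotential a b
  exact ODE_solution_unique_univ (v := fun _ x => -gradient (cellPotential a b) x)
    (s := fun _ => univ) (fun _ => hK.lipschitzOnWith) (fun t => ⟨h t, mem_univ _⟩)
    (fun t => ⟨h' t, mem_univ _⟩) heq

theorem IsGradientFlowLine.hasDerivAt_zero {a b : ℝ} {γ : ℝ → Plane}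
    (h : IsGradientFlowLine (cellPotential a b) γ) (t : ℝ) :
    HasDerivAt (fun t => γ t 0)
      (-(2 * (Real.pi / (2 * a)) * Real.sin (Real.pi / (2 * a) * γ t 0) *
        Real.sin (Real.pi / (2 * b) * γ t 1))) t := by
  have := (EuclideanSpace.proj 0 : Plane →L[ℝ] ℝ).hasFDerivAt.comp_hasDerivAt t (h t)
  beta_reduce at this
  rw [(hasGradientAt_cellPotential a b _).gradient] at this
  refine this.congr_deriv ?_
  simp

theorem IsGradientFlowLine.hasDerivAt_one {a b : ℝ} {γ : ℝ → Plane}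
    (h : IsGradientFlowLine (cellPotential a b) γ) (t : ℝ) :
    HasDerivAt (fun t => γ t 1)
      (2 * (Real.pi / (2 * b)) * Real.cos (Real.pi / (2 * a) * γ t 0) *
        Real.cos (Real.pi / (2 * b) * γ t 1)) t := by
  have := (EuclideanSpace.proj 1 : Plane →L[ℝ] ℝ).hasFDerivAt.comp_hasDerivAt t (h t)
  beta_reduce at this
  rw [(hasGradientAt_cellPotential a b _).gradient] at this
  refine this.congr_deriv ?_
  simp

/-- Solutions of the scalar linear equation `u' = k φ(t) u`. -/
theorem eq_mul_exp_of_hasDerivAt {u φ : ℝ → ℝ} {k : ℝ} (hφ : Continuous φ)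
    (hu : ∀ t, HasDerivAt u (k * φ t * u t) t) (t : ℝ) :
    u t = u 0 * Real.exp (k * ∫ s in (0 : ℝ)..t, φ s) := by
  have hB : ∀ t, HasDerivAt (fun t => ∫ s in (0 : ℝ)..t, φ s) (φ t) t := fun t =>
    intervalIntegral.integral_hasDerivAt_right (hφ.intervalIntegrable _ _)
      (hφ.stronglyMeasurableAtFilter _ _) hφ.continuousAt
  have hd : ∀ t, HasDerivAt (fun t => u t * Real.exp (-(k * ∫ s in (0 : ℝ)..t, φ s))) 0 t := by
    intro t
    refine ((hu t).mul (((hB t).const_mul k).neg.exp)).congr_deriv ?_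
    ring
  have hconst := is_const_of_deriv_eq_zero (fun t => (hd t).differentiableAt)
    (fun t => (hd t).deriv) t 0
  simp only [intervalIntegral.integral_same, mul_zero, neg_zero, Real.exp_zero, mul_one] at hconst
  rw [← hconst, mul_assoc, ← Real.exp_add]
  simp

/-- Along a flow line `sin (α x)` and `cos (β y)` solve linear equations whose rates are
proportional, with factors `α ^ 2` and `β ^ 2`. -/
theorem IsGradientFlowLine.exists_exp {a b : ℝ} {γ : ℝ → Plane}
    (h : IsGradientFlowLine (cellPotential a b) γ) : ∃ B : ℝ → ℝ, ∀ t,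
      Real.sin (Real.pi / (2 * a) * γ t 0) =
        Real.sin (Real.pi / (2 * a) * γ 0 0) * Real.exp ((Real.pi / (2 * a)) ^ 2 * B t) ∧
      Real.cos (Real.pi / (2 * b) * γ t 1) =
        Real.cos (Real.pi / (2 * b) * γ 0 1) * Real.exp ((Real.pi / (2 * b)) ^ 2 * B t) := by
  have hγ : Continuous γ := IsIntegralCurve.continuous h
  have hφ : Continuous fun t => cellPotential a b (γ t) :=
    (differentiable_cellPotential a b).continuous.comp hγ
  refine ⟨fun t => ∫ s in (0 : ℝ)..t, cellPotential a b (γ s), fun t => ⟨?_, ?_⟩⟩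
  · refine eq_mul_exp_of_hasDerivAt
      (u := fun t => Real.sin (Real.pi / (2 * a) * γ t 0)) hφ (fun t => ?_) t
    refine ((h.hasDerivAt_zero t).const_mul (Real.pi / (2 * a))).sin.congr_deriv ?_
    simp only [cellPotential]
    ring
  · refine eq_mul_exp_of_hasDerivAt
      (u := fun t => Real.cos (Real.pi / (2 * b) * γ t 1)) hφ (fun t => ?_) t
    refine ((h.hasDerivAt_one t).const_mul (Real.pi / (2 * b))).cos.congr_deriv ?_
    simp only [cellPotential]
    ring

/-- The first integral: `|sin (α x)| ^ κ` and `cos (β y)` are multiplied by the same positive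
factor along a flow line. -/
theorem IsGradientFlowLine.exists_factor {a b : ℝ} (ha : 0 < a) {γ : ℝ → Plane}
    (h : IsGradientFlowLine (cellPotential a b) γ) : ∃ E : ℝ → ℝ, ∀ t, 0 < E t ∧
      |Real.sin (Real.pi / (2 * a) * γ t 0)| ^ ((a / b) ^ 2) =
        |Real.sin (Real.pi / (2 * a) * γ 0 0)| ^ ((a / b) ^ 2) * E t ∧
      Real.cos (Real.pi / (2 * b) * γ t 1) = Real.cos (Real.pi / (2 * b) * γ 0 1) * E t := by
  obtain ⟨B, hB⟩ := h.exists_exp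
  refine ⟨fun t => Real.exp ((Real.pi / (2 * b)) ^ 2 * B t), fun t => ⟨Real.exp_pos _, ?_, (hB t).2⟩⟩
  rw [(hB t).1, abs_mul, Real.abs_exp, Real.mul_rpow (abs_nonneg _) (Real.exp_pos _).le,
    ← Real.exp_mul]
  congr 2
  field_simp

/-! ### The explicit form of the Neumann domain -/

theorem forall_lt_of_forall_ne {f : ℝ → ℝ} (hf : Continuous f) {c t₀ : ℝ} (hne : ∀ t, f t ≠ c)
    (h₀ : f t₀ < c) (t : ℝ) : f t < c := by
  by_contra! h
  obtain ⟨s, hs⟩ := mem_range_of_exists_le_of_exists_ge hf ⟨t₀, h₀.le⟩ ⟨t, h⟩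
  exact hne s hs

theorem forall_abs_lt_of_forall_ne {f : ℝ → ℝ} (hf : Continuous f) {c t₀ : ℝ}
    (hne : ∀ t, f t ≠ c) (hne' : ∀ t, f t ≠ -c) (h₀ : |f t₀| < c) (t : ℝ) : |f t| < c := by
  rw [abs_lt] at h₀ ⊢
  refine ⟨?_, forall_lt_of_forall_ne hf hne h₀.2 t⟩
  have := forall_lt_of_forall_ne (f := fun t => -f t) hf.neg (c := c) (t₀ := t₀)
    (fun t ht => hne' t (by linarith)) (by linarith) t
  linarith

/-- A trajectory of `w' ≥ k (1 - w²)` in `(-1, 1)` runs up to `1`: the quotient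
`(1 - w) / (1 + w)` decays at least like `exp (-2kt)`. -/
theorem tendsto_one_of_logistic {w w' : ℝ → ℝ} {k : ℝ} (hk : 0 < k)
    (hw : ∀ t, HasDerivAt w (w' t) t) (h : ∀ t, |w t| < 1)
    (hw' : ∀ t, k * (1 - w t ^ 2) ≤ w' t) : Tendsto w atTop (𝓝 1) := by
  have hpos : ∀ t, 0 < 1 + w t := fun t => by linarith [(abs_lt.1 (h t)).1]
  have hpos' : ∀ t, 0 < 1 - w t := fun t => by linarith [(abs_lt.1 (h t)).2]
  have hd : ∀ t, HasDerivAt (fun t => (1 - w t) / (1 + w t) * Real.exp (2 * k * t))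
      (2 * Real.exp (2 * k * t) / (1 + w t) ^ 2 * (k * (1 - w t ^ 2) - w' t)) t := by
    intro t
    have he : HasDerivAt (fun t => Real.exp (2 * k * t)) (Real.exp (2 * k * t) * (2 * k)) t := by
      simpa using ((hasDerivAt_id t).const_mul (2 * k)).exp
    refine ((((hw t).const_sub 1).div ((hw t).const_add 1) (hpos t).ne').mul he).congr_deriv ?_
    have := (hpos t).ne'
    simp only [Pi.div_apply]
    field_simp
    ring
  have hanti : Antitone fun t => (1 - w t) / (1 + w t) * Real.exp (2 * k * t) := by
    refine antitone_of_deriv_nonpos (fun t => (hd t).differentiableAt) fun t => ?_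
    rw [(hd t).deriv]
    exact mul_nonpos_of_nonneg_of_nonpos (by have := hpos t; positivity) (by linarith [hw' t])
  set Z := (1 - w 0) / (1 + w 0)
  have hbound : ∀ t, 0 ≤ t → 1 - 2 * Z * Real.exp (-(2 * k * t)) ≤ w t := by
    intro t ht
    have h1 := hanti ht
    simp only [mul_zero, Real.exp_zero, mul_one] at h1
    have h2 : (1 - w t) / (1 + w t) ≤ Z * Real.exp (-(2 * k * t)) := by
      rw [Real.exp_neg, ← div_eq_mul_inv, le_div_iff₀ (Real.exp_pos _)]
      exact h1
    rw [div_le_iff₀ (hpos t)] at h2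
    have h3 : 0 ≤ Z * Real.exp (-(2 * k * t)) :=
      mul_nonneg (div_pos (hpos' 0) (hpos 0)).le (Real.exp_pos _).le
    nlinarith [(abs_lt.1 (h t)).2]
  have hlim : Tendsto (fun t => 1 - 2 * Z * Real.exp (-(2 * k * t))) atTop (𝓝 1) := by
    have : Tendsto (fun t : ℝ => Real.exp (-(2 * k * t))) atTop (𝓝 0) :=
      Real.tendsto_exp_neg_atTop_nhds_zero.comp (tendsto_id.const_mul_atTop (by positivity))
    simpa using (this.const_mul (2 * Z)).const_sub 1
  exact tendsto_of_tendsto_of_tendsto_of_le_of_le' hlim tendsto_const_nhds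
    (eventually_atTop.2 ⟨0, hbound⟩) (Eventually.of_forall fun t => (abs_lt.1 (h t)).2.le)

theorem tendsto_neg_one_of_logistic {w w' : ℝ → ℝ} {k : ℝ} (hk : 0 < k)
    (hw : ∀ t, HasDerivAt w (w' t) t) (h : ∀ t, |w t| < 1)
    (hw' : ∀ t, k * (1 - w t ^ 2) ≤ w' t) : Tendsto w atBot (𝓝 (-1)) := by
  have := tendsto_one_of_logistic (w := fun t => -w (-t)) (w' := fun t => w' (-t)) hk
    (fun t => ((hw (-t)).scomp t (hasDerivAt_neg t)).neg.congr_deriv (by simp))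
    (fun t => by simpa using h (-t)) (fun t => by simpa using hw' (-t))
  simpa using (this.comp tendsto_neg_atBot_atTop).neg

theorem half_period_mul {a : ℝ} (ha : 0 < a) : Real.pi / (2 * a) * a = Real.pi / 2 := by
  field_simp

theorem abs_half_period_mul_lt {a x : ℝ} (ha : 0 < a) (hx : |x| < a) :
    |Real.pi / (2 * a) * x| < Real.pi / 2 := by
  have : 0 < Real.pi / (2 * a) := by positivity
  rw [abs_mul, abs_of_pos this, ← half_period_mul ha]
  exact mul_lt_mul_of_pos_left hx this

theorem cos_half_period_pos {a x : ℝ} (ha : 0 < a) (hx : |x| < a) :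
    0 < Real.cos (Real.pi / (2 * a) * x) := by
  have := abs_lt.1 (abs_half_period_mul_lt ha hx)
  exact Real.cos_pos_of_mem_Ioo this

theorem tendsto_plane {l : Filter ℝ} {γ : ℝ → Plane} {u v : ℝ}
    (h0 : Tendsto (fun t => γ t 0) l (𝓝 u)) (h1 : Tendsto (fun t => γ t 1) l (𝓝 v)) :
    Tendsto γ l (𝓝 !₂[u, v]) := by
  have h : Tendsto (fun t => WithLp.ofLp (γ t)) l (𝓝 ![u, v]) := by
    rw [tendsto_pi_nhds]
    intro i
    fin_cases i
    · exact h0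
    · exact h1
  exact ((PiLp.continuous_toLp 2 (fun _ : Fin 2 => ℝ)).tendsto _).comp h

theorem Filter.Tendsto.coord {l : Filter ℝ} {γ : ℝ → Plane} {p : Plane}
    (h : Tendsto γ l (𝓝 p)) (i : Fin 2) : Tendsto (fun t => γ t i) l (𝓝 (p i)) :=
  ((EuclideanSpace.proj i : Plane →L[ℝ] ℝ).continuous.tendsto p).comp h

/-- Flow lines on which the first integral is less than `1` stay in the cell: they reach neither
`|x| = a`, where `|sin (α x)| = 1`, nor `|y| = b`, where `cos (β y) = 0`. The three conditions need
not be known at the same time. -/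
theorem IsGradientFlowLine.mem_cell {a b : ℝ} (ha : 0 < a) (hb : 0 < b) {γ : ℝ → Plane}
    (h : IsGradientFlowLine (cellPotential a b) γ) {t₀ : ℝ} (h1 : |γ t₀ 1| < b)
    (h0 : |γ t₀ 0| < a)
    (hlt : |Real.sin (Real.pi / (2 * a) * γ 0 0)| ^ ((a / b) ^ 2) <
      Real.cos (Real.pi / (2 * b) * γ 0 1)) (t : ℝ) :
    γ t ∈ cell a b := by
  have hcont : ∀ i, Continuous fun t => γ t i := fun i =>
    (EuclideanSpace.proj i : Plane →L[ℝ] ℝ).continuous.comp (IsIntegralCurve.continuous h)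
  obtain ⟨E, hE⟩ := h.exists_factor ha
  have hlt' : ∀ t, |Real.sin (Real.pi / (2 * a) * γ t 0)| ^ ((a / b) ^ 2) <
      Real.cos (Real.pi / (2 * b) * γ t 1) := by
    intro t
    rw [(hE t).2.1, (hE t).2.2]
    exact mul_lt_mul_of_pos_right hlt (hE t).1
  have hnonneg : ∀ t, 0 ≤ |Real.sin (Real.pi / (2 * a) * γ t 0)| ^ ((a / b) ^ 2) := fun t =>
    Real.rpow_nonneg (abs_nonneg _) _
  refine ⟨forall_abs_lt_of_forall_ne (hcont 0) (fun t ht => ?_) (fun t ht => ?_) h0 t,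
    forall_abs_lt_of_forall_ne (hcont 1) (fun t ht => ?_) (fun t ht => ?_) h1 t, hlt' t⟩
  · have := hlt' t
    rw [ht, half_period_mul ha, Real.sin_pi_div_two, abs_one, Real.one_rpow] at this
    linarith [Real.cos_le_one (Real.pi / (2 * b) * γ t 1)]
  · have := hlt' t
    rw [ht, mul_neg, half_period_mul ha, Real.sin_neg, Real.sin_pi_div_two, abs_neg, abs_one,
      Real.one_rpow] at this
    linarith [Real.cos_le_one (Real.pi / (2 * b) * γ t 1)]
  · have := hlt' t
    rw [ht, half_period_mul hb, Real.cos_pi_div_two] at this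
    linarith [hnonneg t]
  · have := hlt' t
    rw [ht, mul_neg, half_period_mul hb, Real.cos_neg, Real.cos_pi_div_two] at this
    linarith [hnonneg t]

theorem mem_cell_of_flowLine {a b : ℝ} (ha : 0 < a) (hb : 0 < b) {γ : ℝ → Plane}
    (h : IsGradientFlowLine (cellPotential a b) γ) (hbot : Tendsto γ atBot (𝓝 !₂[0, -b]))
    (htop : Tendsto γ atTop (𝓝 !₂[0, b])) : γ 0 ∈ cell a b := by
  have hcont : ∀ i, Continuous fun t => γ t i := fun i =>
    (EuclideanSpace.proj i : Plane →L[ℝ] ℝ).continuous.comp (IsIntegralCurve.continuous h)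
  have hy : Tendsto (fun t => γ t 1) atTop (𝓝 b) := by simpa using htop.coord 1
  have hy' : Tendsto (fun t => γ t 1) atBot (𝓝 (-b)) := by simpa using hbot.coord 1
  have hx : Tendsto (fun t => γ t 0) atTop (𝓝 0) := by simpa using htop.coord 0
  obtain ⟨E, hE⟩ := h.exists_factor ha
  -- On the lines `cos (β y) = 0` the flow is horizontal, so that no connecting line meets them.
  have hc : ∀ t, Real.cos (Real.pi / (2 * b) * γ t 1) ≠ 0 := by
    have h0 : Real.cos (Real.pi / (2 * b) * γ 0 1) ≠ 0 := by
      intro h0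
      have hd : ∀ t, HasDerivAt (fun t => γ t 1) 0 t := by
        intro t
        refine (h.hasDerivAt_one t).congr_deriv ?_
        rw [(hE t).2.2, h0]
        ring
      have hconst : (fun t => γ t 1) = fun _ => γ 0 1 := funext fun t =>
        is_const_of_deriv_eq_zero (fun t => (hd t).differentiableAt) (fun t => (hd t).deriv) t 0
      rw [hconst] at hy hy'
      have e1 := tendsto_nhds_unique tendsto_const_nhds hy
      have e2 := tendsto_nhds_unique tendsto_const_nhds hy'
      linarith
    intro t
    rw [(hE t).2.2]
    exact mul_ne_zero h0 (hE t).1.ne'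
  obtain ⟨t₁, ht₁⟩ : ∃ t, γ t 1 = 0 := by
    obtain ⟨s, hs⟩ := (hy'.eventually_lt_const (show -b < 0 by linarith)).exists
    obtain ⟨s', hs'⟩ := (hy.eventually_const_lt hb).exists
    exact mem_range_of_exists_le_of_exists_ge (hcont 1) ⟨s, hs.le⟩ ⟨s', hs'.le⟩
  have hlt₁ : |Real.sin (Real.pi / (2 * a) * γ t₁ 0)| < 1 := by
    refine lt_of_le_of_ne (Real.abs_sin_le_one _) fun h1 => ?_
    -- Otherwise the flow line passes through a saddle point, hence is constant.
    have hcos : Real.cos (Real.pi / (2 * a) * γ t₁ 0) = 0 := by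
      have := Real.sin_sq_add_cos_sq (Real.pi / (2 * a) * γ t₁ 0)
      rw [← sq_abs, h1] at this
      exact pow_eq_zero_iff (two_ne_zero) |>.1 (by linarith)
    have hstat : IsGradientFlowLine (cellPotential a b) fun _ => γ t₁ := by
      refine isIntegralCurve_const fun _ => ?_
      rw [(hasGradientAt_cellPotential a b _).gradient]
      ext i
      fin_cases i <;> simp [hcos, ht₁]
    have heq := isGradientFlowLine_cellPotential_unique h hstat (t := t₁) rfl
    rw [heq] at hy
    have := tendsto_nhds_unique tendsto_const_nhds hy
    linarith
  have hlt : |Real.sin (Real.pi / (2 * a) * γ 0 0)| ^ ((a / b) ^ 2) <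
      Real.cos (Real.pi / (2 * b) * γ 0 1) := by
    have h1 : |Real.sin (Real.pi / (2 * a) * γ t₁ 0)| ^ ((a / b) ^ 2) < 1 :=
      Real.rpow_lt_one (abs_nonneg _) hlt₁ (by positivity)
    have h2 : Real.cos (Real.pi / (2 * b) * γ t₁ 1) = 1 := by simp [ht₁]
    rw [← h2, (hE t₁).2.1, (hE t₁).2.2] at h1
    exact lt_of_mul_lt_mul_right h1 (hE t₁).1.le
  obtain ⟨t₂, ht₂⟩ : ∃ t, |γ t 0| < a := by
    have : Tendsto (fun t => |γ t 0|) atTop (𝓝 0) := by simpa using hx.abs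
    exact (this.eventually_lt_const ha).exists
  have hcell : ∀ t, |γ t 1| < b := by
    refine forall_abs_lt_of_forall_ne (t₀ := t₁) (hcont 1) (fun t ht => hc t ?_)
      (fun t ht => hc t ?_) (by simpa [ht₁] using hb)
    · rw [ht, half_period_mul hb, Real.cos_pi_div_two]
    · rw [ht, mul_neg, half_period_mul hb, Real.cos_neg, Real.cos_pi_div_two]
  exact h.mem_cell ha hb (hcell t₂) ht₂ hlt 0

theorem tendsto_of_tendsto_sin {a : ℝ} (ha : 0 < a) {l : Filter ℝ} {f : ℝ → ℝ} {s : ℝ}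
    (hf : ∀ t, |f t| < a)
    (h : Tendsto (fun t => Real.sin (Real.pi / (2 * a) * f t)) l (𝓝 s)) :
    Tendsto f l (𝓝 ((Real.pi / (2 * a))⁻¹ * Real.arcsin s)) := by
  have h1 := ((Real.continuous_arcsin.tendsto s).comp h).const_mul (Real.pi / (2 * a))⁻¹
  refine h1.congr fun t => ?_
  have := abs_lt.1 (abs_half_period_mul_lt ha (hf t))
  rw [Function.comp_apply, Real.arcsin_sin this.1.le this.2.le]
  field_simp

/-- Where `sin (β y)` tends to `±1` along a curve in the cell, `x` tends to `0`, because
`|sin (α x)| ^ κ < cos (β y)`. -/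
theorem tendsto_zero_of_mem_cell {a b : ℝ} (ha : 0 < a) (hb : 0 < b) {γ : ℝ → Plane} {l : Filter ℝ}
    (hγ : ∀ t, γ t ∈ cell a b) {s : ℝ} (hs : s ^ 2 = 1)
    (h : Tendsto (fun t => Real.sin (Real.pi / (2 * b) * γ t 1)) l (𝓝 s)) :
    Tendsto (fun t => γ t 0) l (𝓝 0) := by
  have hκ : 0 < (a / b) ^ 2 := by positivity
  have hcos : Tendsto (fun t => Real.cos (Real.pi / (2 * b) * γ t 1)) l (𝓝 0) := by
    have h1 : Tendsto (fun t => √(1 - Real.sin (Real.pi / (2 * b) * γ t 1) ^ 2)) l (𝓝 0) := by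
      simpa [hs] using ((h.pow 2).const_sub 1).sqrt
    refine h1.congr fun t => ?_
    rw [← Real.cos_sq', Real.sqrt_sq (cos_half_period_pos hb (hγ t).2.1).le]
  have hpow : Tendsto (fun t => |Real.sin (Real.pi / (2 * a) * γ t 0)| ^ ((a / b) ^ 2)) l (𝓝 0) :=
    squeeze_zero (fun t => Real.rpow_nonneg (abs_nonneg _) _) (fun t => (hγ t).2.2.le) hcos
  have habs : Tendsto (fun t => |Real.sin (Real.pi / (2 * a) * γ t 0)|) l (𝓝 0) := by
    have h1 := hpow.rpow_const (p := ((a / b) ^ 2)⁻¹) (Or.inr (by positivity))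
    rw [Real.zero_rpow (inv_ne_zero hκ.ne')] at h1
    refine h1.congr fun t => ?_
    rw [← Real.rpow_mul (abs_nonneg _), mul_inv_cancel₀ hκ.ne', Real.rpow_one]
  simpa using tendsto_of_tendsto_sin ha (fun t => (hγ t).1)
    (tendsto_zero_iff_abs_tendsto_zero _ |>.2 habs)

theorem flowLine_tendsto_of_mem_cell {a b : ℝ} (ha : 0 < a) (hb : 0 < b) {γ : ℝ → Plane}
    (h : IsGradientFlowLine (cellPotential a b) γ) (h0 : γ 0 ∈ cell a b) :
    Tendsto γ atBot (𝓝 !₂[0, -b]) ∧ Tendsto γ atTop (𝓝 !₂[0, b]) := by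
  have hκ : 0 < (a / b) ^ 2 := by positivity
  have hcell : ∀ t, γ t ∈ cell a b := h.mem_cell ha hb (t₀ := 0) h0.2.1 h0.1 h0.2.2
  obtain ⟨E, hE⟩ := h.exists_factor ha
  have hc0 := cos_half_period_pos hb h0.2.1
  -- `K < 1` is the value of the first integral; it keeps `sin (α x)` away from `±1`.
  set K := |Real.sin (Real.pi / (2 * a) * γ 0 0)| ^ ((a / b) ^ 2) /
    Real.cos (Real.pi / (2 * b) * γ 0 1) with hK
  have hK0 : 0 ≤ K := div_nonneg (Real.rpow_nonneg (abs_nonneg _) _) hc0.le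
  have hK1 : K < 1 := (div_lt_one hc0).2 h0.2.2
  set m := K ^ ((a / b) ^ 2)⁻¹ with hm
  have hm1 : m < 1 := Real.rpow_lt_one hK0 hK1 (by positivity)
  have hsin : ∀ t, |Real.sin (Real.pi / (2 * a) * γ t 0)| ≤ m := by
    intro t
    have h1 : |Real.sin (Real.pi / (2 * a) * γ t 0)| ^ ((a / b) ^ 2) ≤ K := by
      have : |Real.sin (Real.pi / (2 * a) * γ t 0)| ^ ((a / b) ^ 2) =
          K * Real.cos (Real.pi / (2 * b) * γ t 1) := by
        rw [(hE t).2.1, (hE t).2.2, hK, ← mul_assoc, div_mul_cancel₀ _ hc0.ne']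
      rw [this]
      exact mul_le_of_le_one_right hK0 (Real.cos_le_one _)
    have h2 := Real.rpow_le_rpow (Real.rpow_nonneg (abs_nonneg _) _) h1 (inv_nonneg.2 hκ.le)
    rwa [← Real.rpow_mul (abs_nonneg _), mul_inv_cancel₀ hκ.ne', Real.rpow_one] at h2
  have hcos : ∀ t, 1 - m ≤ Real.cos (Real.pi / (2 * a) * γ t 0) := by
    intro t
    have hp := cos_half_period_pos ha (hcell t).1
    have h1 := Real.cos_le_one (Real.pi / (2 * a) * γ t 0)
    have h2 := Real.sin_sq_add_cos_sq (Real.pi / (2 * a) * γ t 0)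
    rw [← sq_abs] at h2
    nlinarith [hsin t, abs_nonneg (Real.sin (Real.pi / (2 * a) * γ t 0))]
  have hw : ∀ t, HasDerivAt (fun t => Real.sin (Real.pi / (2 * b) * γ t 1))
      (2 * (Real.pi / (2 * b)) ^ 2 * Real.cos (Real.pi / (2 * a) * γ t 0) *
        (1 - Real.sin (Real.pi / (2 * b) * γ t 1) ^ 2)) t := by
    intro t
    refine ((h.hasDerivAt_one t).const_mul (Real.pi / (2 * b))).sin.congr_deriv ?_
    rw [← Real.cos_sq']
    ring
  have hlt : ∀ t, |Real.sin (Real.pi / (2 * b) * γ t 1)| < 1 := by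
    intro t
    rw [← sq_lt_one_iff_abs_lt_one, Real.sin_sq]
    have := cos_half_period_pos hb (hcell t).2.1
    nlinarith
  have hk : 0 < 2 * (Real.pi / (2 * b)) ^ 2 * (1 - m) :=
    mul_pos (by positivity) (by linarith)
  have hw' : ∀ t, 2 * (Real.pi / (2 * b)) ^ 2 * (1 - m) *
      (1 - Real.sin (Real.pi / (2 * b) * γ t 1) ^ 2) ≤
      2 * (Real.pi / (2 * b)) ^ 2 * Real.cos (Real.pi / (2 * a) * γ t 0) *
        (1 - Real.sin (Real.pi / (2 * b) * γ t 1) ^ 2) := by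
    intro t
    refine mul_le_mul_of_nonneg_right ?_ ?_
    · exact mul_le_mul_of_nonneg_left (hcos t) (by positivity)
    · rw [← Real.cos_sq']
      positivity
  have e : (Real.pi / (2 * b))⁻¹ * (Real.pi / 2) = b := by field_simp
  have htop := tendsto_one_of_logistic hk hw hlt hw'
  have hbot := tendsto_neg_one_of_logistic hk hw hlt hw'
  refine ⟨tendsto_plane (tendsto_zero_of_mem_cell ha hb hcell (by norm_num) hbot) ?_,
    tendsto_plane (tendsto_zero_of_mem_cell ha hb hcell (by norm_num) htop) ?_⟩
  · have := tendsto_of_tendsto_sin hb (fun t => (hcell t).2.1) hbot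
    rwa [Real.arcsin_neg_one, mul_neg, e] at this
  · have := tendsto_of_tendsto_sin hb (fun t => (hcell t).2.1) htop
    rwa [Real.arcsin_one, e] at this

theorem neumannDomain_cellPotential {a b : ℝ} (ha : 0 < a) (hb : 0 < b) :
    neumannDomain (cellPotential a b) !₂[0, -b] !₂[0, b] = cell a b := by
  ext x
  constructor
  · rintro ⟨⟨γ, hγ, h0, hbot⟩, ⟨γ', hγ', h0', htop⟩⟩
    obtain rfl := isGradientFlowLine_cellPotential_unique hγ hγ' (h0.trans h0'.symm)
    exact h0 ▸ mem_cell_of_flowLine ha hb hγ hbot htop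
  · intro hx
    obtain ⟨γ, hγ, rfl⟩ := exists_isGradientFlowLine_cellPotential a b x
    have := flowLine_tendsto_of_mem_cell ha hb hγ hx
    exact ⟨⟨γ, hγ, rfl, this.1⟩, ⟨γ, hγ, rfl, this.2⟩⟩

/-! ### The two Neumann domains as congruent copies of cells -/

/-- The quarter turn `(x, y) ↦ (y, -x)`. -/
noncomputable def quarterTurn : Plane ≃ₗᵢ[ℝ] Plane where
  toFun x := !₂[x 1, -x 0]
  invFun x := !₂[-x 1, x 0]
  map_add' x y := by ext i; fin_cases i <;> simp [add_comm]
  map_smul' c x := by ext i; fin_cases i <;> simp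
  left_inv x := by ext i; fin_cases i <;> simp
  right_inv x := by ext i; fin_cases i <;> simp
  norm_map' x := by simp [EuclideanSpace.norm_eq, Fin.sum_univ_two, add_comm]

theorem quarterTurn_apply (x : Plane) : quarterTurn x = !₂[x 1, -x 0] := rfl

theorem starDomain_eq_preimage_cell {a b : ℝ} (ha : 0 < a) (hb : 0 < b) :
    starDomain a b = (fun x => (1 : ℝ) • quarterTurn x + 0) ⁻¹' cell b a := by
  have hpsi : psi a b = fun x => cellPotential b a ((1 : ℝ) • quarterTurn x + 0) := by
    funext x
    simp [psi, cellPotential, quarterTurn_apply]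
    ring
  rw [starDomain, hpsi, neumannDomain_comp_similarity (differentiable_cellPotential b a) one_pos,
    ← neumannDomain_cellPotential hb ha]
  simp [quarterTurn_apply]

theorem lensDomain_eq_preimage_cell {a b : ℝ} (ha : 0 < a) (hb : 0 < b) :
    lensDomain a b =
      (fun x => (1 : ℝ) • LinearIsometryEquiv.refl ℝ Plane x + !₂[-a, -b]) ⁻¹' cell a b := by
  have hpsi : psi a b =
      fun x => cellPotential a b ((1 : ℝ) • LinearIsometryEquiv.refl ℝ Plane x + !₂[-a, -b]) := by
    funext x
    have h1 : Real.cos (Real.pi / (2 * a) * (x 0 + -a)) = Real.sin (Real.pi / (2 * a) * x 0) := by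
      rw [mul_add, mul_neg, half_period_mul ha, ← sub_eq_add_neg, Real.cos_sub_pi_div_two]
    have h2 : Real.sin (Real.pi / (2 * b) * (x 1 + -b)) = -Real.cos (Real.pi / (2 * b) * x 1) := by
      rw [mul_add, mul_neg, half_period_mul hb, ← sub_eq_add_neg, Real.sin_sub_pi_div_two]
    simp [psi, cellPotential, h1, h2]
  rw [lensDomain, hpsi, neumannDomain_comp_similarity (differentiable_cellPotential a b) one_pos,
    ← neumannDomain_cellPotential ha hb]
  congr 2 <;> ext i <;> fin_cases i <;> simp
  ring

/-- `ρ` is invariant under similarities, the eigenvalue being scaled by the square of the ratio. -/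
theorem rhoValue_preimage_similarity {c : ℝ} (hc : 0 < c) (L : Plane ≃ₗᵢ[ℝ] Plane) (v : Plane)
    (Ω : Set Plane) (μ : ℝ) :
    rhoValue ((fun x => c • L x + v) ⁻¹' Ω) (c ^ 2 * μ) = rhoValue Ω μ := by
  have hpre : ∀ A : Set Plane, (fun x => c • L x + v) ⁻¹' A =
      L ⁻¹' ((fun x => c • x) ⁻¹' ((fun x => x + v) ⁻¹' A)) := fun A => rfl
  have hfront : frontier ((fun x => c • L x + v) ⁻¹' Ω) =
      (fun x => c • L x + v) ⁻¹' frontier Ω := by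
    rw [hpre, hpre]
    have h1 := L.toHomeomorph.preimage_frontier
      ((fun x => c • x) ⁻¹' ((fun x => x + v) ⁻¹' Ω))
    have h2 := (Homeomorph.smulOfNeZero c hc.ne').preimage_frontier ((fun x : Plane => x + v) ⁻¹' Ω)
    have h3 := (Homeomorph.addRight v).preimage_frontier Ω
    simp only [LinearIsometryEquiv.coe_toHomeomorph] at h1
    rw [← h1]
    congr 1
    refine Eq.trans h2.symm ?_
    exact congrArg _ h3.symm
  have hvol : volume ((fun x => c • L x + v) ⁻¹' Ω) = ENNReal.ofReal ((c ^ 2)⁻¹) * volume Ω := by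
    rw [hpre, L.measurePreserving.measure_preimage_emb L.toHomeomorph.measurableEmbedding,
      Measure.addHaar_preimage_smul _ hc.ne', measure_preimage_add_right]
    congr 2
    rw [abs_of_nonneg (by positivity)]
    simp
  have hlen : Measure.hausdorffMeasure 1 ((fun x => c • L x + v) ⁻¹' frontier Ω) =
      ENNReal.ofReal c⁻¹ * Measure.hausdorffMeasure 1 (frontier Ω) := by
    rw [hpre]
    have h1 := L.toIsometryEquiv.hausdorffMeasure_preimage 1
      ((fun x => c • x) ⁻¹' ((fun x => x + v) ⁻¹' frontier Ω))
    refine Eq.trans h1 ?_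
    rw [preimage_smul₀ hc.ne', Measure.hausdorffMeasure_smul₀ zero_le_one (inv_ne_zero hc.ne')]
    have h2 := (IsometryEquiv.addRight v).hausdorffMeasure_preimage 1 (frontier Ω)
    rw [show (fun x => x + v) ⁻¹' frontier Ω = (IsometryEquiv.addRight v) ⁻¹' frontier Ω from rfl,
      h2, NNReal.rpow_one, ENNReal.smul_def, smul_eq_mul]
    congr 1
    rw [ENNReal.ofReal, Real.toNNReal_eq_nnnorm_of_nonneg (inv_pos.2 hc).le]
  rw [rhoValue, rhoValue, hfront, hvol, hlen, ENNReal.toReal_mul, ENNReal.toReal_mul,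
    ENNReal.toReal_ofReal (by positivity), ENNReal.toReal_ofReal (by positivity),
    Real.sqrt_mul (by positivity), Real.sqrt_sq hc.le]
  have : c ≠ 0 := hc.ne'
  rcases eq_or_ne (Measure.hausdorffMeasure 1 (frontier Ω)).toReal 0 with h | h
  · simp [h]
  · field_simp

theorem rhoStar_eq {a b : ℝ} (ha : 0 < a) (hb : 0 < b) :
    rhoStar a b = rhoValue (cell b a) (lam a b) := by
  rw [rhoStar, starDomain_eq_preimage_cell ha hb,
    ← rhoValue_preimage_similarity one_pos quarterTurn 0 (cell b a), one_pow, one_mul]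

theorem rhoLens_eq {a b : ℝ} (ha : 0 < a) (hb : 0 < b) :
    rhoLens a b = rhoValue (cell a b) (lam a b) := by
  rw [rhoLens, lensDomain_eq_preimage_cell ha hb,
    ← rhoValue_preimage_similarity one_pos (.refl ℝ Plane) !₂[-a, -b] (cell a b), one_pow, one_mul]

/-! ### Topology of cells -/

theorem continuous_coord (i : Fin 2) : Continuous fun x : Plane => x i :=
  (EuclideanSpace.proj i : Plane →L[ℝ] ℝ).continuous

theorem continuous_abs_sin_rpow (a b : ℝ) :
    Continuous fun x : Plane => |Real.sin (Real.pi / (2 * a) * x 0)| ^ ((a / b) ^ 2) :=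
  ((Real.continuous_sin.comp (continuous_const.mul (continuous_coord 0))).abs).rpow_const
    fun _ => Or.inr (sq_nonneg _)

theorem continuous_cos_coord (b : ℝ) :
    Continuous fun x : Plane => Real.cos (Real.pi / (2 * b) * x 1) :=
  Real.continuous_cos.comp (continuous_const.mul (continuous_coord 1))

theorem isOpen_cell (a b : ℝ) : IsOpen (cell a b) :=
  (isOpen_lt (continuous_coord 0).abs continuous_const).inter
    ((isOpen_lt (continuous_coord 1).abs continuous_const).inter
      (isOpen_lt (continuous_abs_sin_rpow a b) (continuous_cos_coord b)))

theorem abs_sin_half_period_lt_one {a x : ℝ} (ha : 0 < a) (hx : |x| < a) :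
    |Real.sin (Real.pi / (2 * a) * x)| < 1 := by
  rw [← sq_lt_one_iff_abs_lt_one, Real.sin_sq]
  have := cos_half_period_pos ha hx
  nlinarith

theorem abs_sin_half_period_eq_one {a x : ℝ} (ha : 0 < a) (hx : |x| = a) :
    |Real.sin (Real.pi / (2 * a) * x)| = 1 := by
  rcases (abs_eq ha.le).1 hx with rfl | rfl
  · rw [half_period_mul ha, Real.sin_pi_div_two, abs_one]
  · rw [mul_neg, half_period_mul ha, Real.sin_neg, Real.sin_pi_div_two, abs_neg, abs_one]

theorem cos_half_period_eq_zero {a x : ℝ} (ha : 0 < a) (hx : |x| = a) :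
    Real.cos (Real.pi / (2 * a) * x) = 0 := by
  rcases (abs_eq ha.le).1 hx with rfl | rfl
  · rw [half_period_mul ha, Real.cos_pi_div_two]
  · rw [mul_neg, half_period_mul ha, Real.cos_neg, Real.cos_pi_div_two]

theorem abs_half_period_mul_le {a x : ℝ} (ha : 0 < a) (hx : |x| ≤ a) :
    |Real.pi / (2 * a) * x| ≤ Real.pi / 2 := by
  have : 0 < Real.pi / (2 * a) := by positivity
  rw [abs_mul, abs_of_pos this, ← half_period_mul ha]
  exact mul_le_mul_of_nonneg_left hx this.le

theorem cos_half_period_lt_cos {b x y : ℝ} (hb : 0 < b) (hx : |x| ≤ b) (hyx : |y| < |x|) :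
    Real.cos (Real.pi / (2 * b) * x) < Real.cos (Real.pi / (2 * b) * y) := by
  have hpos : 0 < Real.pi / (2 * b) := by positivity
  rw [← Real.cos_abs (_ * x), ← Real.cos_abs (_ * y)]
  refine Real.cos_lt_cos_of_nonneg_of_le_pi_div_two (abs_nonneg _)
    (abs_half_period_mul_le hb hx) ?_
  rw [abs_mul, abs_mul, abs_of_pos hpos]
  exact mul_lt_mul_of_pos_left hyx hpos

theorem abs_sin_half_period {a x : ℝ} (ha : 0 < a) (hx : |x| ≤ a) :
    |Real.sin (Real.pi / (2 * a) * x)| = Real.sin (Real.pi / (2 * a) * |x|) := by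
  have hpos : 0 < Real.pi / (2 * a) := by positivity
  have h := abs_half_period_mul_le ha hx
  rw [← abs_of_pos hpos, ← abs_mul, abs_of_pos hpos]
  exact Real.abs_sin_eq_sin_abs_of_abs_le_pi (by linarith [Real.pi_pos])

theorem abs_sin_half_period_le {a x y : ℝ} (ha : 0 < a) (hx : |x| ≤ a) (hyx : |y| ≤ |x|) :
    |Real.sin (Real.pi / (2 * a) * y)| ≤ |Real.sin (Real.pi / (2 * a) * x)| := by
  have hpos : 0 < Real.pi / (2 * a) := by positivity
  rw [abs_sin_half_period ha hx, abs_sin_half_period ha (hyx.trans hx)]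
  have h := mul_le_mul_of_nonneg_left hx hpos.le
  rw [half_period_mul ha] at h
  have h0 : 0 ≤ Real.pi / (2 * a) * |y| := by positivity
  exact Real.sin_le_sin_of_le_of_le_pi_div_two (by linarith [Real.pi_pos]) h
    (mul_le_mul_of_nonneg_left hyx hpos.le)

/-- Cells are star-shaped about the origin, strictly so at the curve bounding them. -/
theorem smul_mem_cell {a b : ℝ} (ha : 0 < a) (hb : 0 < b) {x : Plane} (h0 : |x 0| ≤ a)
    (h1 : |x 1| ≤ b)
    (h : |Real.sin (Real.pi / (2 * a) * x 0)| ^ ((a / b) ^ 2) = Real.cos (Real.pi / (2 * b) * x 1))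
    {s : ℝ} (hs0 : 0 ≤ s) (hs1 : s < 1) : s • x ∈ cell a b := by
  have hκ : 0 < (a / b) ^ 2 := by positivity
  have e : ∀ i, (s • x) i = s * x i := fun i => rfl
  have hle : ∀ i, |s * x i| ≤ |x i| := fun i => by
    rw [abs_mul, abs_of_nonneg hs0]
    exact mul_le_of_le_one_left (abs_nonneg _) hs1.le
  have hlt : ∀ i c, 0 < c → |x i| ≤ c → |s * x i| < c := fun i c hc hi => by
    rw [abs_mul, abs_of_nonneg hs0]
    nlinarith [abs_nonneg (x i)]
  refine ⟨by rw [e]; exact hlt 0 a ha h0, by rw [e]; exact hlt 1 b hb h1, ?_⟩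
  rw [e, e]
  by_cases hx : x 1 = 0
  · rw [hx, mul_zero, mul_zero, Real.cos_zero]
    exact Real.rpow_lt_one (abs_nonneg _) (abs_sin_half_period_lt_one ha (hlt 0 a ha h0)) hκ
  · calc _ ≤ |Real.sin (Real.pi / (2 * a) * x 0)| ^ ((a / b) ^ 2) :=
          Real.rpow_le_rpow (abs_nonneg _) (abs_sin_half_period_le ha h0 (hle 0)) hκ.le
      _ = Real.cos (Real.pi / (2 * b) * x 1) := h
      _ < _ := by
          refine cos_half_period_lt_cos hb h1 ?_
          rw [abs_mul, abs_of_nonneg hs0]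
          exact mul_lt_of_lt_one_left (abs_pos.2 hx) hs1

theorem frontier_cell {a b : ℝ} (ha : 0 < a) (hb : 0 < b) :
    frontier (cell a b) = {x | |x 0| ≤ a ∧ |x 1| ≤ b ∧
      |Real.sin (Real.pi / (2 * a) * x 0)| ^ ((a / b) ^ 2) =
        Real.cos (Real.pi / (2 * b) * x 1)} := by
  have hκ : 0 < (a / b) ^ 2 := by positivity
  rw [(isOpen_cell a b).frontier_eq]
  ext x
  constructor
  · rintro ⟨hcl, hx⟩
    have hclosed : IsClosed {x : Plane | |x 0| ≤ a ∧ |x 1| ≤ b ∧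
        |Real.sin (Real.pi / (2 * a) * x 0)| ^ ((a / b) ^ 2) ≤
          Real.cos (Real.pi / (2 * b) * x 1)} :=
      (isClosed_le (continuous_coord 0).abs continuous_const).inter
        ((isClosed_le (continuous_coord 1).abs continuous_const).inter
          (isClosed_le (continuous_abs_sin_rpow a b) (continuous_cos_coord b)))
    obtain ⟨h0, h1, h⟩ := hclosed.closure_subset_iff.2
      (show cell a b ⊆ _ from fun y hy => ⟨hy.1.le, hy.2.1.le, hy.2.2.le⟩) hcl
    refine ⟨h0, h1, h.eq_of_not_lt fun hlt => hx ⟨h0.lt_of_ne fun h0' => ?_,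
      h1.lt_of_ne fun h1' => ?_, hlt⟩⟩
    · rw [abs_sin_half_period_eq_one ha h0', Real.one_rpow] at hlt
      linarith [Real.cos_le_one (Real.pi / (2 * b) * x 1)]
    · rw [cos_half_period_eq_zero hb h1'] at hlt
      exact absurd hlt (not_lt.2 (Real.rpow_nonneg (abs_nonneg _) _))
  · rintro ⟨h0, h1, h⟩
    refine ⟨?_, fun hx => hx.2.2.ne h⟩
    have hlim : Tendsto (fun s : ℝ => s • x) (𝓝[<] 1) (𝓝 x) := by
      have : Tendsto (fun s : ℝ => s • x) (𝓝 1) (𝓝 ((1 : ℝ) • x)) :=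
        (continuous_id.smul continuous_const).tendsto 1
      rw [one_smul] at this
      exact this.mono_left nhdsWithin_le_nhds
    refine mem_closure_of_tendsto hlim ?_
    filter_upwards [Ioo_mem_nhdsLT (show (0 : ℝ) < 1 from one_pos)] with s hs
    exact smul_mem_cell ha hb h0 h1 h hs.1.le hs.2

/-! ### The boundary curve -/

/-- The part of the boundary of a cell in the closed first quadrant. -/
def cellArc (a b : ℝ) : Set Plane := frontier (cell a b) ∩ {x | 0 ≤ x 0} ∩ {x | 0 ≤ x 1}

theorem mem_cellArc {a b : ℝ} (ha : 0 < a) (hb : 0 < b) {x : Plane} :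
    x ∈ cellArc a b ↔ x 0 ∈ Icc 0 a ∧ x 1 ∈ Icc 0 b ∧
      Real.sin (Real.pi / (2 * a) * x 0) ^ ((a / b) ^ 2) = Real.cos (Real.pi / (2 * b) * x 1) := by
  rw [cellArc, frontier_cell ha hb]
  constructor
  · rintro ⟨⟨⟨h0, h1, h⟩, p0⟩, p1⟩
    have p0 : 0 ≤ x 0 := p0
    have p1 : 0 ≤ x 1 := p1
    rw [abs_sin_half_period ha h0, abs_of_nonneg p0] at h
    rw [abs_of_nonneg p0] at h0
    rw [abs_of_nonneg p1] at h1
    exact ⟨⟨p0, h0⟩, ⟨p1, h1⟩, h⟩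
  · rintro ⟨⟨p0, h0⟩, ⟨p1, h1⟩, h⟩
    refine ⟨⟨⟨by rwa [abs_of_nonneg p0], by rwa [abs_of_nonneg p1], ?_⟩, p0⟩, p1⟩
    rwa [abs_sin_half_period ha (by rwa [abs_of_nonneg p0]), abs_of_nonneg p0]

/-- The reflection of the plane that changes the sign of the coordinate `i`. -/
noncomputable def reflectCoord (i : Fin 2) (x : Plane) : Plane :=
  WithLp.toLp 2 fun j => if j = i then -x j else x j

theorem isometry_reflectCoord (i : Fin 2) : Isometry (reflectCoord i) := by
  refine Isometry.of_dist_eq fun x y => ?_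
  rw [EuclideanSpace.dist_eq, EuclideanSpace.dist_eq]
  congr 1
  refine Finset.sum_congr rfl fun j _ => ?_
  simp only [reflectCoord]
  split_ifs <;> simp

theorem reflectCoord_reflectCoord (i : Fin 2) (x : Plane) :
    reflectCoord i (reflectCoord i x) = x := by
  ext j
  simp only [reflectCoord]
  split_ifs <;> simp

theorem hausdorffMeasure_eq_two_mul_of_symm {s : Set Plane} (i : Fin 2)
    (hs : ∀ x ∈ s, reflectCoord i x ∈ s)
    (h0 : Measure.hausdorffMeasure 1 (s ∩ {x | x i = 0}) = 0) :
    Measure.hausdorffMeasure 1 s = 2 * Measure.hausdorffMeasure 1 (s ∩ {x | 0 ≤ x i}) := by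
  have hi : ∀ x, reflectCoord i x i = -x i := fun x => by simp [reflectCoord]
  have hmeas : MeasurableSet {x : Plane | 0 ≤ x i} :=
    (isClosed_le continuous_const (continuous_coord i)).measurableSet
  have himage : reflectCoord i '' (s ∩ {x | 0 < x i}) = s \ {x | 0 ≤ x i} := by
    ext y
    constructor
    · rintro ⟨x, ⟨hx, hpos⟩, rfl⟩
      refine ⟨hs x hx, ?_⟩
      simpa [hi] using hpos
    · rintro ⟨hy, hneg⟩
      refine ⟨reflectCoord i y, ⟨hs y hy, ?_⟩, reflectCoord_reflectCoord i y⟩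
      simpa [hi] using hneg
  have hneg : Measure.hausdorffMeasure 1 (s \ {x : Plane | 0 ≤ x i}) =
      Measure.hausdorffMeasure 1 (s ∩ {x | 0 < x i}) := by
    rw [← himage, (isometry_reflectCoord i).hausdorffMeasure_image (Or.inl zero_le_one)]
  have hpos : Measure.hausdorffMeasure 1 (s ∩ {x : Plane | 0 < x i}) =
      Measure.hausdorffMeasure 1 (s ∩ {x | 0 ≤ x i}) := by
    refine le_antisymm (measure_mono fun x hx => ⟨hx.1, (show 0 < x i from hx.2).le⟩) ?_
    calc _ ≤ Measure.hausdorffMeasure 1 ((s ∩ {x : Plane | 0 < x i}) ∪ (s ∩ {x | x i = 0})) :=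
          measure_mono fun x hx => (lt_or_eq_of_le (show 0 ≤ x i from hx.2)).imp (fun h => ⟨hx.1, h⟩)
            fun h => ⟨hx.1, h.symm⟩
      _ ≤ _ := (measure_union_le _ _).trans (by rw [h0, add_zero])
  rw [← measure_inter_add_sdiff s hmeas, hneg, hpos, two_mul]

theorem plane_eq {x : Plane} {u v : ℝ} (h0 : x 0 = u) (h1 : x 1 = v) : x = !₂[u, v] := by
  ext i
  fin_cases i
  · exact h0
  · exact h1

theorem hausdorffMeasure_frontier_cell {a b : ℝ} (ha : 0 < a) (hb : 0 < b) :
    Measure.hausdorffMeasure 1 (frontier (cell a b)) =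
      4 * Measure.hausdorffMeasure 1 (cellArc a b) := by
  have hκ : 0 < (a / b) ^ 2 := by positivity
  have hnull : ∀ p q : Plane, Measure.hausdorffMeasure 1 ({p, q} : Set Plane) = 0 := by
    have := Measure.nullSingletonClass_hausdorff Plane one_pos
    exact fun p q => (Set.toFinite _).measure_zero _
  have h1 : Measure.hausdorffMeasure 1 (frontier (cell a b)) =
      2 * Measure.hausdorffMeasure 1 (frontier (cell a b) ∩ {x | 0 ≤ x 0}) := by
    rw [frontier_cell ha hb]
    refine hausdorffMeasure_eq_two_mul_of_symm 0 ?_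
      (measure_mono_null ?_ (hnull !₂[0, b] !₂[0, -b]))
    · rintro x ⟨h0, h1, h⟩
      simpa [reflectCoord] using ⟨h0, h1, h⟩
    · rintro x ⟨⟨-, h1, h⟩, h0⟩
      have h0 : x 0 = 0 := h0
      have : |x 1| = b := h1.eq_of_not_lt fun hlt => by
        have := cos_half_period_pos hb hlt
        rw [← h, h0, mul_zero, Real.sin_zero, abs_zero, Real.zero_rpow hκ.ne'] at this
        exact this.false
      rcases (abs_eq hb.le).1 this with h | h
      · exact Or.inl (plane_eq h0 h)
      · exact Or.inr (plane_eq h0 h)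
  have h2 : Measure.hausdorffMeasure 1 (frontier (cell a b) ∩ {x | 0 ≤ x 0}) =
      2 * Measure.hausdorffMeasure 1 (cellArc a b) := by
    rw [cellArc, frontier_cell ha hb]
    refine hausdorffMeasure_eq_two_mul_of_symm 1 ?_
      (measure_mono_null ?_ (hnull !₂[a, 0] !₂[-a, 0]))
    · rintro x ⟨⟨h0, h1, h⟩, hp⟩
      simpa [reflectCoord] using ⟨⟨h0, h1, h⟩, hp⟩
    · rintro x ⟨⟨⟨h0, -, h⟩, -⟩, h1⟩
      have h1 : x 1 = 0 := h1
      have : |x 0| = a := h0.eq_of_not_lt fun hlt => by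
        have := Real.rpow_lt_one (abs_nonneg _) (abs_sin_half_period_lt_one ha hlt) hκ
        rw [h, h1, mul_zero, Real.cos_zero] at this
        exact this.false
      rcases (abs_eq ha.le).1 this with h | h
      · exact Or.inl (plane_eq h h1)
      · exact Or.inr (plane_eq h h1)
  rw [h1, h2, ← mul_assoc]
  norm_num

/-- The isometry `(x, y) ↦ (b - y, a - x)`, which exchanges the arcs of `cell a b` and `cell b a`. -/
noncomputable def arcSwap (a b : ℝ) (x : Plane) : Plane := !₂[b - x 1, a - x 0]

theorem isometry_arcSwap (a b : ℝ) : Isometry (arcSwap a b) := by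
  refine Isometry.of_dist_eq fun x y => ?_
  rw [EuclideanSpace.dist_eq, EuclideanSpace.dist_eq, Fin.sum_univ_two, Fin.sum_univ_two, add_comm]
  simp only [arcSwap, Matrix.cons_val_zero, Matrix.cons_val_one, Real.dist_eq, sq_abs]
  ring_nf

theorem arcSwap_mem_cellArc {a b : ℝ} (ha : 0 < a) (hb : 0 < b) {x : Plane}
    (hx : x ∈ cellArc a b) : arcSwap a b x ∈ cellArc b a := by
  rw [mem_cellArc ha hb] at hx
  rw [mem_cellArc hb ha]
  obtain ⟨⟨p0, h0⟩, ⟨p1, h1⟩, h⟩ := hx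
  simp only [arcSwap, Matrix.cons_val_zero, Matrix.cons_val_one]
  refine ⟨⟨by linarith, by linarith⟩, ⟨by linarith, by linarith⟩, ?_⟩
  have hsin : 0 ≤ Real.sin (Real.pi / (2 * a) * x 0) := by
    rw [← abs_of_nonneg p0, ← abs_sin_half_period ha (by rwa [abs_of_nonneg p0])]
    exact abs_nonneg _
  rw [mul_sub, mul_sub, half_period_mul ha, half_period_mul hb, Real.sin_pi_div_two_sub,
    Real.cos_pi_div_two_sub, ← h, ← Real.rpow_mul hsin, ← mul_pow,
    div_mul_div_cancel₀ hb.ne', div_self ha.ne', one_pow, Real.rpow_one]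

theorem hausdorffMeasure_cellArc_swap {a b : ℝ} (ha : 0 < a) (hb : 0 < b) :
    Measure.hausdorffMeasure 1 (cellArc b a) = Measure.hausdorffMeasure 1 (cellArc a b) := by
  have : arcSwap a b '' cellArc a b = cellArc b a := by
    refine Subset.antisymm (image_subset_iff.2 fun x hx => arcSwap_mem_cellArc ha hb hx) ?_
    intro y hy
    refine ⟨arcSwap b a y, arcSwap_mem_cellArc hb ha hy, ?_⟩
    ext i
    fin_cases i <;> simp [arcSwap]
  rw [← this, (isometry_arcSwap a b).hausdorffMeasure_image (Or.inl zero_le_one)]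

theorem abs_coord_sub_le_dist (x y : Plane) (i : Fin 2) : |x i - y i| ≤ dist x y := by
  rw [dist_eq_norm]
  simpa using PiLp.norm_apply_le (x - y) i

theorem dist_le_abs_add_abs (x y : Plane) : dist x y ≤ |x 0 - y 0| + |x 1 - y 1| := by
  rw [EuclideanSpace.dist_eq, Fin.sum_univ_two, Real.dist_eq, Real.dist_eq]
  refine Real.sqrt_le_iff.2 ⟨by positivity, ?_⟩
  nlinarith [mul_nonneg (abs_nonneg (x 0 - y 0)) (abs_nonneg (x 1 - y 1))]

theorem cellArc_antitone {a b : ℝ} (ha : 0 < a) (hb : 0 < b) {x y : Plane}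
    (hx : x ∈ cellArc a b) (hy : y ∈ cellArc a b) (h : x 0 ≤ y 0) : y 1 ≤ x 1 := by
  rw [mem_cellArc ha hb] at hx hy
  obtain ⟨⟨px0, hx0⟩, ⟨px1, hx1⟩, hx⟩ := hx
  obtain ⟨⟨py0, hy0⟩, ⟨py1, hy1⟩, hy⟩ := hy
  by_contra! hlt
  have h1 := cos_half_period_lt_cos hb (x := y 1) (y := x 1) (by rwa [abs_of_nonneg py1])
    (by rwa [abs_of_nonneg px1, abs_of_nonneg py1])
  have h2 := abs_sin_half_period_le ha (x := y 0) (y := x 0) (by rwa [abs_of_nonneg py0])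
    (by rwa [abs_of_nonneg px0, abs_of_nonneg py0])
  rw [abs_sin_half_period ha (by rwa [abs_of_nonneg px0]),
    abs_sin_half_period ha (by rwa [abs_of_nonneg py0]), abs_of_nonneg px0,
    abs_of_nonneg py0] at h2
  have hsin : 0 ≤ Real.sin (Real.pi / (2 * a) * x 0) := by
    rw [← abs_of_nonneg px0, ← abs_sin_half_period ha (by rwa [abs_of_nonneg px0])]
    exact abs_nonneg _
  have h3 := Real.rpow_le_rpow hsin h2 (sq_nonneg (a / b))
  linarith

/-- A decreasing arc has finite length: it is a `1`-Lipschitz image of a bounded set of values of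
`x - y`. -/
theorem hausdorffMeasure_cellArc_lt_top {a b : ℝ} (ha : 0 < a) (hb : 0 < b) :
    Measure.hausdorffMeasure 1 (cellArc a b) < ⊤ := by
  set s : Plane → ℝ := fun x => x 0 - x 1 with hs
  have hdist : ∀ x ∈ cellArc a b, ∀ y ∈ cellArc a b, dist x y ≤ dist (s x) (s y) := by
    have key : ∀ x ∈ cellArc a b, ∀ y ∈ cellArc a b, x 0 ≤ y 0 → dist x y ≤ dist (s x) (s y) := by
      intro x hx y hy h
      have h1 := cellArc_antitone ha hb hx hy h
      refine (dist_le_abs_add_abs x y).trans ?_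
      rw [Real.dist_eq, abs_of_nonpos (by linarith), abs_of_nonneg (by linarith),
        abs_of_nonpos (by simp only [hs]; linarith)]
      simp only [hs]
      linarith
    intro x hx y hy
    rcases le_total (x 0) (y 0) with h | h
    · exact key x hx y hy h
    · rw [dist_comm x, dist_comm (s x)]
      exact key y hy x hx h
  have hinv : ∀ r ∈ s '' cellArc a b, ∃ x ∈ cellArc a b, s x = r := fun r hr => hr
  choose! g hg hsg using hinv
  have hlip : LipschitzOnWith 1 g (s '' cellArc a b) := by
    refine LipschitzOnWith.of_dist_le_mul fun r hr r' hr' => ?_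
    have := hdist _ (hg r hr) _ (hg r' hr')
    rwa [hsg r hr, hsg r' hr', ← one_mul (dist r r')] at this
  have himage : cellArc a b ⊆ g '' (s '' cellArc a b) := by
    intro x hx
    refine ⟨s x, mem_image_of_mem s hx, ?_⟩
    have h := hdist _ (hg _ (mem_image_of_mem s hx)) _ hx
    rw [hsg _ (mem_image_of_mem s hx), dist_self] at h
    exact dist_le_zero.1 h
  have hsub : s '' cellArc a b ⊆ Icc (-b) a := by
    rintro _ ⟨x, hx, rfl⟩
    obtain ⟨⟨p0, h0⟩, ⟨p1, h1⟩, -⟩ := (mem_cellArc ha hb).1 hx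
    constructor <;> simp only [hs] <;> linarith
  calc Measure.hausdorffMeasure 1 (cellArc a b)
      ≤ Measure.hausdorffMeasure 1 (g '' (s '' cellArc a b)) := measure_mono himage
    _ ≤ Measure.hausdorffMeasure 1 (s '' cellArc a b) := by
        simpa using hlip.hausdorffMeasure_image_le (d := 1) zero_le_one
    _ ≤ Measure.hausdorffMeasure 1 (Icc (-b) a) := measure_mono hsub
    _ < ⊤ := by rw [hausdorffMeasure_real, Real.volume_Icc]; exact ENNReal.ofReal_lt_top

/-- The arc projects onto the interval `[0, a]`, so that its length is at least `a`. -/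
theorem hausdorffMeasure_cellArc_pos {a b : ℝ} (ha : 0 < a) (hb : 0 < b) :
    0 < Measure.hausdorffMeasure 1 (cellArc a b) := by
  have hκ : 0 < (a / b) ^ 2 := by positivity
  have hlip : LipschitzWith 1 fun x : Plane => x 0 :=
    LipschitzWith.of_dist_le_mul fun x y => by
      simpa [Real.dist_eq] using abs_coord_sub_le_dist x y 0
  have hsub : Icc 0 a ⊆ (fun x : Plane => x 0) '' cellArc a b := by
    rintro u ⟨hu0, hua⟩
    have hua' : |u| ≤ a := by rwa [abs_of_nonneg hu0]
    have hsin : 0 ≤ Real.sin (Real.pi / (2 * a) * u) := by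
      rw [← abs_of_nonneg hu0, ← abs_sin_half_period ha hua']
      exact abs_nonneg _
    set w := Real.sin (Real.pi / (2 * a) * u) ^ ((a / b) ^ 2) with hw
    have hw0 : 0 ≤ w := Real.rpow_nonneg hsin _
    have hw1 : w ≤ 1 := Real.rpow_le_one hsin (Real.sin_le_one _) hκ.le
    have hβ : 0 < Real.pi / (2 * b) := by positivity
    refine ⟨!₂[u, (Real.pi / (2 * b))⁻¹ * Real.arccos w], (mem_cellArc ha hb).2 ?_, rfl⟩
    simp only [Matrix.cons_val_zero, Matrix.cons_val_one]
    refine ⟨⟨hu0, hua⟩, ⟨mul_nonneg (inv_pos.2 hβ).le (Real.arccos_nonneg _), ?_⟩, ?_⟩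
    · rw [inv_mul_le_iff₀ hβ, half_period_mul hb]
      exact Real.arccos_le_pi_div_two.2 hw0
    · rw [mul_inv_cancel_left₀ hβ.ne', Real.cos_arccos (by linarith) hw1]
  calc (0 : ENNReal) < ENNReal.ofReal a := ENNReal.ofReal_pos.2 ha
    _ = Measure.hausdorffMeasure 1 (Icc 0 a) := by
        rw [hausdorffMeasure_real, Real.volume_Icc, sub_zero]
    _ ≤ Measure.hausdorffMeasure 1 ((fun x : Plane => x 0) '' cellArc a b) := measure_mono hsub
    _ ≤ _ := by simpa using hlip.hausdorffMeasure_image_le zero_le_one (cellArc a b)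

/-! ### Comparison of areas -/

theorem abs_sin_lt_cos_iff {a b x y : ℝ} (ha : 0 < a) (hb : 0 < b) (hx : |x| ≤ a) (hy : |y| ≤ b) :
    |Real.sin (Real.pi / (2 * a) * x)| < Real.cos (Real.pi / (2 * b) * y) ↔
      |x| / a + |y| / b < 1 := by
  have hx' := abs_half_period_mul_le ha hx
  have hy' := abs_half_period_mul_le hb hy
  have hπ := Real.pi_pos
  rw [abs_mul, abs_of_pos (by positivity)] at hx' hy'
  have hx0 : 0 ≤ Real.pi / (2 * a) * |x| := by positivity
  have hy0 : 0 ≤ Real.pi / (2 * b) * |y| := by positivity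
  rw [abs_sin_half_period ha hx, ← Real.cos_abs (_ * y), abs_mul,
    abs_of_pos (show 0 < Real.pi / (2 * b) by positivity), ← Real.cos_pi_div_two_sub,
    Real.strictAntiOn_cos.lt_iff_gt ⟨by linarith, by linarith⟩ ⟨hy0, by linarith⟩]
  have e : Real.pi / 2 - (Real.pi / (2 * a) * |x| + Real.pi / (2 * b) * |y|) =
      Real.pi / 2 * (1 - (|x| / a + |y| / b)) := by
    field_simp
  constructor
  · intro h
    have h1 : 0 < Real.pi / 2 * (1 - (|x| / a + |y| / b)) := by rw [← e]; linarith
    have := pos_of_mul_pos_right h1 (by positivity)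
    linarith
  · intro h
    have h1 : 0 < Real.pi / 2 * (1 - (|x| / a + |y| / b)) := mul_pos (by positivity) (by linarith)
    rw [← e] at h1
    linarith

/-- The open rhombus with vertices `(±a, 0)` and `(0, ±b)`. -/
def rhombus (a b : ℝ) : Set Plane := {x | |x 0| / a + |x 1| / b < 1}

theorem isOpen_rhombus (a b : ℝ) : IsOpen (rhombus a b) :=
  isOpen_lt (((continuous_coord 0).abs.div_const _).add ((continuous_coord 1).abs.div_const _))
    continuous_const

theorem volume_rhombus_swap (a b : ℝ) : volume (rhombus b a) = volume (rhombus a b) := by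
  have : quarterTurn ⁻¹' rhombus b a = rhombus a b := by
    ext x
    simp [rhombus, quarterTurn_apply, add_comm]
  rw [← this, quarterTurn.measurePreserving.measure_preimage
    (isOpen_rhombus b a).measurableSet.nullMeasurableSet]

theorem cell_subset_rhombus {a b : ℝ} (ha : 0 < a) (hab : a ≤ b) : cell a b ⊆ rhombus a b := by
  have hb : 0 < b := ha.trans_le hab
  rintro x ⟨h0, h1, h⟩
  refine (abs_sin_lt_cos_iff ha hb h0.le h1.le).1 (lt_of_le_of_lt ?_ h)
  have hκ : (a / b) ^ 2 ≤ 1 := pow_le_one₀ (by positivity) ((div_le_one hb).2 hab)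
  simpa using Real.rpow_le_rpow_of_exponent_ge' (abs_nonneg _) (Real.abs_sin_le_one _)
    (sq_nonneg (a / b)) hκ

theorem rhombus_subset_cell {a b : ℝ} (hb : 0 < b) (hba : b ≤ a) : rhombus a b ⊆ cell a b := by
  have ha : 0 < a := hb.trans_le hba
  intro x hx
  have hx' : |x 0| / a + |x 1| / b < 1 := hx
  have p0 : 0 ≤ |x 0| / a := by positivity
  have p1 : 0 ≤ |x 1| / b := by positivity
  have h0 : |x 0| < a := (div_lt_one ha).1 (by linarith)
  have h1 : |x 1| < b := (div_lt_one hb).1 (by linarith)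
  refine ⟨h0, h1, lt_of_le_of_lt ?_ ((abs_sin_lt_cos_iff ha hb h0.le h1.le).2 hx)⟩
  have hκ : 1 ≤ (a / b) ^ 2 := one_le_pow₀ ((one_le_div hb).2 hba)
  simpa using Real.rpow_le_rpow_of_exponent_ge' (abs_nonneg _) (Real.abs_sin_le_one _)
    zero_le_one hκ

theorem volume_cell_lt_top {a b : ℝ} : volume (cell a b) < ⊤ := by
  refine lt_of_le_of_lt (measure_mono fun x hx => ?_)
    (measure_ball_lt_top (x := (0 : Plane)) (r := a + b))
  rw [Metric.mem_ball]
  refine (dist_le_abs_add_abs x 0).trans_lt ?_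
  simpa using add_lt_add hx.1 hx.2.1

theorem volume_cell_pos {a b : ℝ} (ha : 0 < a) (hb : 0 < b) : 0 < volume (cell a b) := by
  refine (isOpen_cell a b).measure_pos volume ⟨0, ?_⟩
  have : (a / b) ^ 2 ≠ 0 := by positivity
  simp [cell, ha, hb, Real.zero_rpow this]

/-- For `b < a` the exponent `(a / b) ^ 2` exceeds `1`, and the midpoint of a side of the rhombus
is interior to the cell. -/
theorem volume_rhombus_lt_volume_cell {a b : ℝ} (hb : 0 < b) (hba : b < a) :
    volume (rhombus a b) < volume (cell a b) := by
  have ha : 0 < a := hb.trans hba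
  set U : Set Plane := cell a b ∩ {x | 1 < x 0 / a + x 1 / b} with hU
  have hUopen : IsOpen U := (isOpen_cell a b).inter
    (isOpen_lt continuous_const
      (((continuous_coord 0).div_const _).add ((continuous_coord 1).div_const _)))
  have hmid : (!₂[a / 2, b / 2] : Plane) ∈ cell a b := by
    refine ⟨?_, ?_, ?_⟩
    · exact (abs_of_pos (half_pos ha)).trans_lt (half_lt_self ha)
    · exact (abs_of_pos (half_pos hb)).trans_lt (half_lt_self hb)
    · have e0 : Real.pi / (2 * a) * (a / 2) = Real.pi / 4 := by field_simp; norm_num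
      have e1 : Real.pi / (2 * b) * (b / 2) = Real.pi / 4 := by field_simp; norm_num
      simp only [Matrix.cons_val_zero, Matrix.cons_val_one]
      rw [e0, e1, Real.sin_pi_div_four, Real.cos_pi_div_four, abs_of_pos (by positivity)]
      have h2 : √2 / 2 < 1 := by
        have : √2 < 2 := (Real.sqrt_lt' two_pos).2 (by norm_num)
        linarith
      have hκ : 1 < (a / b) ^ 2 := one_lt_pow₀ ((one_lt_div hb).2 hba) two_ne_zero
      simpa using Real.rpow_lt_rpow_of_exponent_gt (show 0 < √2 / 2 by positivity) h2 hκ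
  have hUne : U.Nonempty := by
    have hlim : Tendsto (fun s : ℝ => s • (!₂[a / 2, b / 2] : Plane)) (𝓝[>] 1)
        (𝓝 !₂[a / 2, b / 2]) := by
      have : Tendsto (fun s : ℝ => s • (!₂[a / 2, b / 2] : Plane)) (𝓝 1)
          (𝓝 ((1 : ℝ) • !₂[a / 2, b / 2])) := (continuous_id.smul continuous_const).tendsto 1
      rw [one_smul] at this
      exact this.mono_left nhdsWithin_le_nhds
    obtain ⟨s, hs, hs1⟩ := ((hlim.eventually ((isOpen_cell a b).mem_nhds hmid)).and
      self_mem_nhdsWithin).exists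
    refine ⟨_, hs, ?_⟩
    have hs1 : 1 < s := hs1
    have e : s * (a / 2) / a + s * (b / 2) / b = s := by field_simp; norm_num
    simpa [e] using hs1
  have hdisj : Disjoint (rhombus a b) U := by
    rw [Set.disjoint_left]
    rintro x hx ⟨-, hx'⟩
    have hx : |x 0| / a + |x 1| / b < 1 := hx
    have hx' : 1 < x 0 / a + x 1 / b := hx'
    have h0 := div_le_div_of_nonneg_right (le_abs_self (x 0)) ha.le
    have h1 := div_le_div_of_nonneg_right (le_abs_self (x 1)) hb.le
    linarith
  have hsub := rhombus_subset_cell hb hba.le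
  have hfin : volume (rhombus a b) ≠ ⊤ := ((measure_mono hsub).trans_lt volume_cell_lt_top).ne
  calc volume (rhombus a b) < volume (rhombus a b) + volume U :=
        ENNReal.lt_add_right hfin (hUopen.measure_pos volume hUne).ne'
    _ = volume (rhombus a b ∪ U) := (measure_union hdisj hUopen.measurableSet).symm
    _ ≤ volume (cell a b) := measure_mono (union_subset hsub inter_subset_left)

theorem volume_cell_lt_volume_cell {a b : ℝ} (hb : 0 < b) (hba : b < a) :
    volume (cell b a) < volume (cell a b) :=
  calc volume (cell b a) ≤ volume (rhombus b a) := measure_mono (cell_subset_rhombus hb hba.le)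
    _ = volume (rhombus a b) := volume_rhombus_swap a b
    _ < volume (cell a b) := volume_rhombus_lt_volume_cell hb hba

theorem lam_pos {a b : ℝ} (ha : 0 < a) (hb : 0 < b) : 0 < lam a b := by
  unfold lam
  positivity

theorem rhoStar_pos_and_lt_rhoLens {a b : ℝ} (hb : 0 < b) (hba : b < a) :
    0 < rhoStar a b ∧ rhoStar a b < rhoLens a b := by
  have ha : 0 < a := hb.trans hba
  have hlen : Measure.hausdorffMeasure 1 (frontier (cell b a)) =
      Measure.hausdorffMeasure 1 (frontier (cell a b)) := by
    rw [hausdorffMeasure_frontier_cell hb ha, hausdorffMeasure_frontier_cell ha hb,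
      hausdorffMeasure_cellArc_swap ha hb]
  have hpos : 0 < (Measure.hausdorffMeasure 1 (frontier (cell a b))).toReal := by
    rw [hausdorffMeasure_frontier_cell ha hb]
    have h1 := hausdorffMeasure_cellArc_pos ha hb
    have h2 := hausdorffMeasure_cellArc_lt_top ha hb
    refine ENNReal.toReal_pos (mul_ne_zero (by norm_num) h1.ne')
      (ENNReal.mul_ne_top (by norm_num) h2.ne)
  have hsqrt : 0 < √(lam a b) := Real.sqrt_pos.2 (lam_pos ha hb)
  have hvol : 0 < (volume (cell b a)).toReal :=
    ENNReal.toReal_pos (volume_cell_pos hb ha).ne' volume_cell_lt_top.ne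
  have hlt : (volume (cell b a)).toReal < (volume (cell a b)).toReal :=
    (ENNReal.toReal_lt_toReal volume_cell_lt_top.ne volume_cell_lt_top.ne).2
      (volume_cell_lt_volume_cell hb hba)
  rw [rhoStar_eq ha hb, rhoLens_eq ha hb, rhoValue, rhoValue, hlen]
  exact ⟨by positivity, by gcongr⟩

/-! ### Neumann eigenfunctions under homotheties -/

theorem measurableEmbedding_homothety {c : ℝ} (hc : 0 < c) :
    MeasurableEmbedding fun x : Plane => c • x :=
  (Homeomorph.smulOfNeZero c hc.ne').measurableEmbedding

theorem map_restrict_preimage_homothety {c : ℝ} (hc : 0 < c) (Ω : Set Plane) :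
    (volume.restrict ((fun x : Plane => c • x) ⁻¹' Ω)).map (fun x => c • x) =
      ENNReal.ofReal ((c ^ 2)⁻¹) • volume.restrict Ω := by
  rw [← (measurableEmbedding_homothety hc).restrict_map, Measure.map_addHaar_smul _ hc.ne',
    Measure.restrict_smul, abs_of_nonneg (by positivity)]
  simp

theorem ae_comp_homothety {c : ℝ} (hc : 0 < c) {Ω : Set Plane} {p : Plane → Prop}
    (h : ∀ᵐ x ∂volume.restrict Ω, p x) :
    ∀ᵐ x ∂volume.restrict ((fun x : Plane => c • x) ⁻¹' Ω), p (c • x) := by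
  rw [← (measurableEmbedding_homothety hc).ae_map_iff (p := p),
    map_restrict_preimage_homothety hc]
  exact Measure.ae_smul_measure h _

theorem setIntegral_comp_homothety {c : ℝ} (hc : 0 < c) (Ω : Set Plane) (f : Plane → ℝ) :
    ∫ x in (fun x : Plane => c • x) ⁻¹' Ω, f (c • x) = (c ^ 2)⁻¹ * ∫ x in Ω, f x := by
  rw [← (measurableEmbedding_homothety hc).integral_map, map_restrict_preimage_homothety hc,
    integral_smul_measure, ENNReal.toReal_ofReal (by positivity), smul_eq_mul]

theorem memLp_comp_homothety {E : Type*} [NormedAddCommGroup E] {c : ℝ} (hc : 0 < c)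
    {Ω : Set Plane} {f : Plane → E} (hf : MemLp f 2 (volume.restrict Ω)) :
    MemLp (fun x => f (c • x)) 2 (volume.restrict ((fun x : Plane => c • x) ⁻¹' Ω)) := by
  have h := hf.smul_measure (c := ENNReal.ofReal ((c ^ 2)⁻¹)) ENNReal.ofReal_ne_top
  rw [← map_restrict_preimage_homothety hc] at h
  exact (measurableEmbedding_homothety hc).memLp_map_measure_iff.1 h

theorem eLpNorm_comp_homothety {c : ℝ} (hc : 0 < c) (Ω : Set Plane) (f : Plane → ℝ) :
    eLpNorm (fun x => f (c • x)) 2 (volume.restrict ((fun x : Plane => c • x) ⁻¹' Ω)) =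
      ENNReal.ofReal c⁻¹ * eLpNorm f 2 (volume.restrict Ω) := by
  have h := (measurableEmbedding_homothety hc).eLpNorm_map_measure (g := f) (p := 2)
    (μ := volume.restrict ((fun x : Plane => c • x) ⁻¹' Ω))
  rw [map_restrict_preimage_homothety hc,
    eLpNorm_smul_measure_of_ne_top (by norm_num), smul_eq_mul] at h
  refine Eq.trans h.symm ?_
  congr 1
  rw [show (1 / (2 : ENNReal)).toReal = 1 / 2 by simp, ENNReal.ofReal_rpow_of_pos (by positivity),
    ← Real.sqrt_eq_rpow, Real.sqrt_inv, Real.sqrt_sq hc.le]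

theorem preimage_homothety_inv {c : ℝ} (hc : 0 < c) (Ω : Set Plane) :
    (fun x : Plane => c⁻¹ • x) ⁻¹' ((fun x : Plane => c • x) ⁻¹' Ω) = Ω := by
  ext x
  simp [smul_smul, hc.ne']

theorem HasH1Gradient.comp_homothety {c : ℝ} (hc : 0 < c) {Ω : Set Plane} {u : Plane → ℝ}
    {g : Plane → Plane} (h : HasH1Gradient Ω u g) :
    HasH1Gradient ((fun x : Plane => c • x) ⁻¹' Ω) (fun x => u (c • x)) (fun x => c • g (c • x)) := by
  refine ⟨memLp_comp_homothety hc h.1, (memLp_comp_homothety hc h.2.1).const_smul c,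
    fun φ hφ hsupp hΩ i => ?_⟩
  -- The test function is transported to `Ω`.
  set φ' : Plane → ℝ := fun x => φ (c⁻¹ • x) with hφ'
  have hφφ' : ∀ x, φ x = φ' (c • x) := fun x => by simp [hφ', smul_smul, hc.ne']
  have hsm : ContDiff ℝ ∞ φ' := hφ.comp (contDiff_const_smul _)
  have hsupp' : HasCompactSupport φ' :=
    hsupp.comp_homeomorph (Homeomorph.smulOfNeZero c⁻¹ (inv_ne_zero hc.ne'))
  have hΩ' : tsupport φ' ⊆ Ω := by
    have : tsupport φ' ⊆ (fun x : Plane => c⁻¹ • x) ⁻¹' tsupport φ :=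
      tsupport_comp_subset_preimage φ (continuous_const_smul _)
    intro x hx
    have := hΩ (this hx)
    simpa [smul_smul, hc.ne'] using this
  have hfd : ∀ x (e : Plane), fderiv ℝ φ x e = c * fderiv ℝ φ' (c • x) e := by
    intro x e
    have h1 := ((hsm.differentiable (by simp)) (c • x)).hasFDerivAt.comp x
      ((hasFDerivAt_id x).const_smul c)
    have h2 : φ = φ' ∘ HSMul.hSMul c := funext fun x => hφφ' x
    rw [← h2] at h1
    rw [h1.fderiv]
    simp
  have key := h.2.2 φ' hsm hsupp' hΩ' i
  have e1 : ∀ x, u (c • x) * fderiv ℝ φ x (EuclideanSpace.single i 1) =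
      c * (fun y => u y * fderiv ℝ φ' y (EuclideanSpace.single i 1)) (c • x) := fun x => by
    rw [hfd]; ring
  have e2 : ∀ x, (c • g (c • x)) i * φ x = c * (fun y => g y i * φ' y) (c • x) := fun x => by
    rw [hφφ', PiLp.smul_apply, smul_eq_mul]; ring
  simp only [e1, e2]
  rw [integral_const_mul, integral_const_mul,
    setIntegral_comp_homothety hc Ω fun y => u y * fderiv ℝ φ' y (EuclideanSpace.single i 1),
    setIntegral_comp_homothety hc Ω fun y => g y i * φ' y, key]
  ring

theorem HasH1Gradient.const_mul {Ω : Set Plane} {u : Plane → ℝ} {g : Plane → Plane}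
    (h : HasH1Gradient Ω u g) (r : ℝ) :
    HasH1Gradient Ω (fun x => r * u x) (fun x => r • g x) := by
  refine ⟨h.1.const_mul r, h.2.1.const_smul r, fun φ hφ hsupp hΩ i => ?_⟩
  have key := h.2.2 φ hφ hsupp hΩ i
  simp only [PiLp.smul_apply, smul_eq_mul, mul_assoc, integral_const_mul, key, mul_neg]

theorem IsNeumannEigenfunction.const_mul {Ω : Set Plane} {μ : ℝ} {u : Plane → ℝ}
    (h : IsNeumannEigenfunction Ω μ u) {r : ℝ} (hr : r ≠ 0) :
    IsNeumannEigenfunction Ω μ (fun x => r * u x) := by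
  obtain ⟨g, hg, hne, heq⟩ := h
  refine ⟨fun x => r • g x, hg.const_mul r, fun h0 => hne ?_, fun w k hwk => ?_⟩
  · filter_upwards [h0] with x hx
    simpa [hr] using hx
  · have key := heq w k hwk
    simp only [real_inner_smul_left, mul_assoc, integral_const_mul, key]
    ring

theorem IsNeumannEigenfunction.comp_homothety {c : ℝ} (hc : 0 < c) {Ω : Set Plane} {μ : ℝ}
    {u : Plane → ℝ} (h : IsNeumannEigenfunction Ω μ u) :
    IsNeumannEigenfunction ((fun x : Plane => c • x) ⁻¹' Ω) (c ^ 2 * μ) (fun x => u (c • x)) := by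
  obtain ⟨g, hg, hne, heq⟩ := h
  refine ⟨_, hg.comp_homothety hc, fun h0 => hne ?_, fun w k hwk => ?_⟩
  · have := ae_comp_homothety (inv_pos.2 hc) h0
    rw [preimage_homothety_inv hc] at this
    filter_upwards [this] with x hx
    simpa [smul_smul, hc.ne'] using hx
  · have hwk' := hwk.comp_homothety (inv_pos.2 hc)
    rw [preimage_homothety_inv hc] at hwk'
    have key := heq _ _ hwk'
    have e1 : ∀ x, inner ℝ (c • g (c • x)) (k x) =
        c ^ 2 * (fun y => inner ℝ (g y) (c⁻¹ • k (c⁻¹ • y))) (c • x) := fun x => by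
      have : c ≠ 0 := hc.ne'
      simp only [smul_smul, inv_mul_cancel₀ this, one_smul, real_inner_smul_left,
        real_inner_smul_right]
      field_simp
    have e2 : ∀ x, u (c • x) * w x = (fun y => u y * w (c⁻¹ • y)) (c • x) := fun x => by
      simp [smul_smul, hc.ne']
    simp only [e1, e2]
    rw [integral_const_mul, setIntegral_comp_homothety hc Ω fun y => inner ℝ (g y) (c⁻¹ • k (c⁻¹ • y)),
      setIntegral_comp_homothety hc Ω fun y => u y * w (c⁻¹ • y), key]
    ring

theorem IsAEConst.comp_homothety {c : ℝ} (hc : 0 < c) {Ω : Set Plane} {u : Plane → ℝ}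
    (h : IsAEConst Ω u) : IsAEConst ((fun x : Plane => c • x) ⁻¹' Ω) (fun x => u (c • x)) := by
  obtain ⟨r, hr⟩ := h
  exact ⟨r, ae_comp_homothety hc hr⟩

theorem exists_nonconst_eigenfunction_comp_homothety {c : ℝ} (hc : 0 < c) {Ω : Set Plane} {μ : ℝ}
    (h : ∃ u, IsNeumannEigenfunction Ω μ u ∧ ¬ IsAEConst Ω u) :
    ∃ u, IsNeumannEigenfunction ((fun x : Plane => c • x) ⁻¹' Ω) (c ^ 2 * μ) u ∧
      ¬ IsAEConst ((fun x : Plane => c • x) ⁻¹' Ω) u := by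
  obtain ⟨u, hu, hne⟩ := h
  refine ⟨_, hu.comp_homothety hc, fun hconst => hne ?_⟩
  have := hconst.comp_homothety (inv_pos.2 hc)
  rw [preimage_homothety_inv hc] at this
  simpa [smul_smul, hc.ne'] using this

theorem IsFirstNonconstantEigenvalue.comp_homothety {c : ℝ} (hc : 0 < c) {Ω : Set Plane} {μ : ℝ}
    (h : IsFirstNonconstantEigenvalue Ω μ) :
    IsFirstNonconstantEigenvalue ((fun x : Plane => c • x) ⁻¹' Ω) (c ^ 2 * μ) := by
  refine ⟨exists_nonconst_eigenfunction_comp_homothety hc h.1, fun ν hν => ?_⟩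
  have hν' := exists_nonconst_eigenfunction_comp_homothety (inv_pos.2 hc) hν
  rw [preimage_homothety_inv hc] at hν'
  have hle : μ ≤ c⁻¹ ^ 2 * ν := h.2 hν'
  rwa [inv_pow, le_inv_mul_iff₀ (by positivity)] at hle

theorem IsSimpleEigenvalue.comp_homothety {c : ℝ} (hc : 0 < c) {Ω : Set Plane} {μ : ℝ}
    (h : IsSimpleEigenvalue Ω μ) :
    IsSimpleEigenvalue ((fun x : Plane => c • x) ⁻¹' Ω) (c ^ 2 * μ) := by
  intro u v hu hv
  have hu' := hu.comp_homothety (inv_pos.2 hc)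
  have hv' := hv.comp_homothety (inv_pos.2 hc)
  have e : c⁻¹ ^ 2 * (c ^ 2 * μ) = μ := by
    have := hc.ne'
    field_simp
  rw [preimage_homothety_inv hc, e] at hu' hv'
  obtain ⟨r, hr⟩ := h _ _ hu' hv'
  refine ⟨r, ?_⟩
  filter_upwards [ae_comp_homothety hc hr] with x hx
  simpa [smul_smul, hc.ne'] using hx

theorem IsGroundState.comp_homothety {c : ℝ} (hc : 0 < c) {Ω : Set Plane} {u : Plane → ℝ}
    (h : IsGroundState Ω u) :
    IsGroundState ((fun x : Plane => c • x) ⁻¹' Ω) (fun x => c * u (c • x)) := by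
  obtain ⟨μ, h1, h2, h3, h4⟩ := h
  refine ⟨c ^ 2 * μ, h1.comp_homothety hc, h2.comp_homothety hc,
    (h3.comp_homothety hc).const_mul hc.ne', ?_⟩
  rw [eLpNorm_comp_homothety hc Ω fun y => c * u y, show (fun y => c * u y) = c • u from rfl,
    eLpNorm_const_smul, h4, mul_one, ← ofReal_norm, Real.norm_of_nonneg hc.le,
    ← ENNReal.ofReal_mul (by positivity), inv_mul_cancel₀ hc.ne', ENNReal.ofReal_one]

theorem HasGroundStateProperty.comp_homothety {c : ℝ} (hc : 0 < c) {Ω : Set Plane}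
    {f : Plane → ℝ} (h : HasGroundStateProperty Ω f) :
    HasGroundStateProperty ((fun x : Plane => c • x) ⁻¹' Ω) (fun x => f (c • x)) := by
  obtain ⟨u, hu, hf⟩ := h
  have hnorm : ((eLpNorm (fun x => f (c • x)) 2
      (volume.restrict ((fun x : Plane => c • x) ⁻¹' Ω))).toReal)⁻¹ =
      c * ((eLpNorm f 2 (volume.restrict Ω)).toReal)⁻¹ := by
    rw [eLpNorm_comp_homothety hc, ENNReal.toReal_mul,
      ENNReal.toReal_ofReal (inv_pos.2 hc).le, mul_inv, inv_inv]
  refine ⟨_, hu.comp_homothety hc, hf.imp (fun hf => ?_) fun hf => ?_⟩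
  · filter_upwards [ae_comp_homothety hc hf] with x hx
    rw [hx, hnorm, mul_assoc]
  · filter_upwards [ae_comp_homothety hc hf] with x hx
    rw [hx, hnorm, mul_neg, mul_assoc]

theorem hasGroundStateProperty_homothety_iff {c : ℝ} (hc : 0 < c) {Ω : Set Plane}
    {f : Plane → ℝ} :
    HasGroundStateProperty ((fun x : Plane => c • x) ⁻¹' Ω) (fun x => f (c • x)) ↔
      HasGroundStateProperty Ω f := by
  refine ⟨fun h => ?_, fun h => h.comp_homothety hc⟩
  have := h.comp_homothety (inv_pos.2 hc)
  rw [preimage_homothety_inv hc] at this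
  simpa [smul_smul, hc.ne'] using this

/-! ### Dependence on the ratio of the sides -/

theorem psi_homothety {c : ℝ} (hc : 0 < c) (a b : ℝ) :
    psi a b = fun x => psi (c * a) (c * b) (c • x) := by
  have : c ≠ 0 := hc.ne'
  have e : ∀ a y : ℝ, Real.pi / (2 * (c * a)) * (c * y) = Real.pi / (2 * a) * y := by
    intro a y
    field_simp
  funext x
  simp [psi, e]

theorem differentiable_psi (a b : ℝ) : Differentiable ℝ (psi a b) := by
  have h : ∀ i, Differentiable ℝ fun x : Plane => x i := fun i =>
    (EuclideanSpace.proj i : Plane →L[ℝ] ℝ).differentiable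
  exact (((h 0).const_mul _).sin.const_mul 2).mul ((h 1).const_mul _).cos

theorem neumannDomain_psi_homothety {c : ℝ} (hc : 0 < c) (a b : ℝ) (p q : Plane) :
    neumannDomain (psi a b) p q =
      (fun x => c • x) ⁻¹' neumannDomain (psi (c * a) (c * b)) (c • p) (c • q) := by
  have := neumannDomain_comp_similarity (differentiable_psi (c * a) (c * b)) hc
    (.refl ℝ Plane) 0 p q
  simp only [LinearIsometryEquiv.coe_refl, id_eq, add_zero] at this
  rw [psi_homothety hc a b, this]

theorem smul_plane (c u v : ℝ) : c • (!₂[u, v] : Plane) = !₂[c * u, c * v] := by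
  ext i
  fin_cases i <;> simp

theorem starDomain_homothety {c : ℝ} (hc : 0 < c) (a b : ℝ) :
    starDomain a b = (fun x => c • x) ⁻¹' starDomain (c * a) (c * b) := by
  rw [starDomain, neumannDomain_psi_homothety hc, smul_plane, smul_plane, mul_zero, mul_neg]
  rfl

theorem lensDomain_homothety {c : ℝ} (hc : 0 < c) (a b : ℝ) :
    lensDomain a b = (fun x => c • x) ⁻¹' lensDomain (c * a) (c * b) := by
  rw [lensDomain, neumannDomain_psi_homothety hc, smul_plane, smul_plane, mul_zero,
    mul_left_comm c 2 b]
  rfl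

theorem lam_homothety {c : ℝ} (hc : 0 < c) (a b : ℝ) : lam a b = c ^ 2 * lam (c * a) (c * b) := by
  have : c ≠ 0 := hc.ne'
  simp only [lam, mul_pow, mul_inv]
  field_simp

theorem rhoValue_homothety {c : ℝ} (hc : 0 < c) (Ω : Set Plane) (μ : ℝ) :
    rhoValue ((fun x : Plane => c • x) ⁻¹' Ω) (c ^ 2 * μ) = rhoValue Ω μ := by
  simpa using rhoValue_preimage_similarity hc (.refl ℝ Plane) 0 Ω μ

theorem mainTheorem10 :
    (∀ a b : ℝ, 0 < b → b < a → 0 < rhoStar a b ∧ rhoStar a b < rhoLens a b) ∧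
    (∀ a b a' b' : ℝ, 0 < b → b < a → 0 < b' → b' < a' → a / b = a' / b' →
      (HasGroundStateProperty (starDomain a b) (psi a b) ↔
        HasGroundStateProperty (starDomain a' b') (psi a' b')) ∧
      (HasGroundStateProperty (lensDomain a b) (psi a b) ↔
        HasGroundStateProperty (lensDomain a' b') (psi a' b')) ∧
      rhoStar a b = rhoStar a' b' ∧
      rhoLens a b = rhoLens a' b') := by
  refine ⟨fun a b hb hba => rhoStar_pos_and_lt_rhoLens hb hba, ?_⟩
  intro a b a' b' hb hba hb' hba' hratio
  have ha : 0 < a := hb.trans hba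
  have ha' : 0 < a' := hb'.trans hba'
  obtain ⟨c, hc, rfl, rfl⟩ : ∃ c : ℝ, 0 < c ∧ a' = c * a ∧ b' = c * b := by
    refine ⟨a' / a, by positivity, by field_simp, ?_⟩
    rw [div_eq_div_iff hb.ne' hb'.ne'] at hratio
    field_simp
    linarith
  rw [rhoStar, rhoLens, rhoStar, rhoLens, starDomain_homothety hc a b, lensDomain_homothety hc a b,
    lam_homothety hc a b, psi_homothety hc a b]
  exact ⟨hasGroundStateProperty_homothety_iff hc, hasGroundStateProperty_homothety_iff hc,
    rhoValue_homothety hc _ _, rhoValue_homothety hc _ _⟩
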